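/- Let $d\ge 0$ and $c\in\mathbb R$ with $d+|c|\neq 0$. Let $J\in C(\mathbb R)$ be even and nonnegative with $\int_{\mathbb R}J(s)\,ds=1$ and $\int_{\mathbb R}J(s)e^{\rho s}\,ds<\infty$ for every $\rho\in\mathbb R$, and write $(J*u)(x)=\int_{\mathbb R}J(x-y)u(y)\,dy$. Let $f=f(r,s)\in C^{2,\alpha}(\mathbb R\times\mathbb R)$ for some $0<\alpha\le 1$ (that is, $f$ is $C^2$ and its second derivatives are $\alpha$-Hölder continuous on compact sets) satisfy, for some $q\in(-1,1)$: (i) $f(-1,-1)=f(1,1)=f(q,q)=0$; (ii) $\partial_s f(r,s)>0$ for all $(r,s)\in[-1,1]\times[-1,1]$; (iii) $\partial_r f(1,1)<0$, $\partial_r f(-1,-1)<0$, $\partial_r f(1,1)<-\partial_s f(1,1)$ and $\partial_r f(-1,-1)<-\partial_s f(-1,-1)$; (iv) the function $\bar f(s)=f(s,s)$ has exactly the three zeros $-1,q,1$, and there is an interval $[l,l']\subset(-1,1)$ containing $q$ such that $\bar f'\ge 0$ on $[l,l']$ and $\bar f'\le 0$ on $[-1,1]\setminus[l,l']$. Let $(c,U)$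 be a monotone traveling wave of $u_t=d\,u_{xx}+f(u,J*u)$ connecting $-1$ to $1$, that is, $U\in C^2(\mathbb R)$ satisfies $$cU'=dU''+f(U,J*U)\ \text{ on }\mathbb R,\qquad \lim_{\xi\to\pm\infty}U(\xi)=\pm1,\qquad U'>0\ \text{ on }\mathbb R.$$ Put $a^\pm=\partial_r f(\pm1,\pm1)$, $b^\pm=\partial_s f(\pm1,\pm1)$ and $$\Delta_\pm(z)=dz^2-cz+a^\pm+b^\pm\int_{\mathbb R}J(s)e^{-zs}\,ds,\qquad z\in\mathbb C.$$ Then each of $\Delta_+$ and $\Delta_-$ has precisely two real zeros, $\lambda^s_+<0<\lambda^u_+$ and $\lambda^s_-<0<\lambda^u_-$ respectively, and there are constants $D_1,D_2>0$ such that $$U(\xi)=1-D_1e^{\lambda^s_+\xi}\,(1+o(1))\quad(\xi\to+\infty),\qquad U(\xi)=-1+D_2e^{\lambda^u_-\xi}\,(1+o(1))\quad(\xi\to-\infty).$$ -/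

import Mathlib

open Filter Topology MeasureTheory
open scoped NNReal

namespace NonlocalWave

noncomputable section

/-- The spatial convolution `(J * u)(x) = ∫ J(x - y) u(y) dy` (Mathlib's convolution). -/
def conv (J u : ℝ → ℝ) : ℝ → ℝ :=
  convolution J u (ContinuousLinearMap.lsmul ℝ ℝ) volume

theorem conv_apply (J u : ℝ → ℝ) (x : ℝ) : conv J u x = ∫ y, J (x - y) * u y := by
  simp [conv, convolution_lsmul_swap]

/-- The partial derivative in the first variable of `f = f(r, s)`. -/
def partialR (f : ℝ × ℝ → ℝ) (r s : ℝ) : ℝ := deriv (fun r' : ℝ => f (r', s)) r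

/-- The partial derivative in the second variable of `f = f(r, s)`. -/
def partialS (f : ℝ × ℝ → ℝ) (r s : ℝ) : ℝ := deriv (fun s' : ℝ => f (r, s')) s

/-- The kernel is continuous, even, nonnegative, of mass one, and has all exponential moments. -/
structure IsKernel (J : ℝ → ℝ) : Prop where
  continuous : Continuous J
  even : ∀ s, J (-s) = J s
  nonneg : ∀ s, 0 ≤ J s
  mass_one : ∫ s, J s = 1
  exp_moment : ∀ ρ : ℝ, Integrable (fun s => J s * Real.exp (ρ * s))

/-- `f` is of class `C^{2,α}`: twice continuously differentiable, with second derivative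
Hölder continuous of exponent `α` on every compact set. -/
structure IsC2Holder (α : ℝ≥0) (f : ℝ × ℝ → ℝ) : Prop where
  contDiff : ContDiff ℝ 2 f
  holder : ∀ K : Set (ℝ × ℝ), IsCompact K →
    ∃ C : ℝ≥0, HolderOnWith C α (iteratedFDeriv ℝ 2 f) K

/-- `g` is bistable with zeros `-1 < q < 1`: these are its only zeros, and there is an interval
`[l, l'] ⊂ (-1, 1)` around `q` with `g' ≥ 0` on `[l, l']` and `g' ≤ 0` on `[-1, 1] \ [l, l']`. -/
structure IsBistable (g : ℝ → ℝ) (q : ℝ) : Prop where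
  zeros : ∀ s : ℝ, g s = 0 ↔ s = -1 ∨ s = q ∨ s = 1
  interval : ∃ l l' : ℝ, -1 < l ∧ l' < 1 ∧ q ∈ Set.Icc l l' ∧
    (∀ s ∈ Set.Icc l l', 0 ≤ deriv g s) ∧
    (∀ s ∈ Set.Icc (-1 : ℝ) 1 \ Set.Icc l l', deriv g s ≤ 0)

/-- The standing hypotheses on the nonlinearity `f = f(r, s)`. -/
structure IsNonlinearity (α : ℝ≥0) (q : ℝ) (f : ℝ × ℝ → ℝ) : Prop where
  smooth : IsC2Holder α f
  q_mem : q ∈ Set.Ioo (-1 : ℝ) 1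
  zero_neg_one : f (-1, -1) = 0
  zero_one : f (1, 1) = 0
  zero_q : f (q, q) = 0
  partialS_pos : ∀ r ∈ Set.Icc (-1 : ℝ) 1, ∀ s ∈ Set.Icc (-1 : ℝ) 1, 0 < partialS f r s
  partialR_one_neg : partialR f 1 1 < 0
  partialR_neg_one_neg : partialR f (-1) (-1) < 0
  stable_one : partialR f 1 1 < -partialS f 1 1
  stable_neg_one : partialR f (-1) (-1) < -partialS f (-1) (-1)
  bistable : IsBistable (fun s => f (s, s)) q

/-- `(c, U)` is a monotone traveling wave of `u_t = d u_xx + f(u, J * u)` connecting `-1` to `1`,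
with `u(x, t) = U(x + c t)`. -/
structure IsTravelingWave (d : ℝ) (J : ℝ → ℝ) (f : ℝ × ℝ → ℝ) (c : ℝ) (U : ℝ → ℝ) : Prop where
  contDiff : ContDiff ℝ 2 U
  equation : ∀ ξ, c * deriv U ξ = d * deriv (deriv U) ξ + f (U ξ, conv J U ξ)
  tendsto_atTop : Tendsto U atTop (𝓝 1)
  tendsto_atBot : Tendsto U atBot (𝓝 (-1))
  deriv_pos : ∀ ξ, 0 < deriv U ξ

/-- The characteristic function `Δ(z) = d z² - c z + a + b ∫ J(s) e^{-z s} ds`. -/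
def charFn (d c a b : ℝ) (J : ℝ → ℝ) (z : ℂ) : ℂ :=
  d * z ^ 2 - c * z + a + b * ∫ s : ℝ, (J s : ℂ) * Complex.exp (-z * s)

/-- The characteristic function of the linearization at the equilibrium `e` (`e = 1` or `-1`). -/
def charFnAt (d c : ℝ) (J : ℝ → ℝ) (f : ℝ × ℝ → ℝ) (e : ℝ) : ℂ → ℂ :=
  charFn d c (partialR f e e) (partialS f e e) J

/-- The real zeros of `Δ` are precisely `ls` and `lu`, and `ls < 0 < lu`. -/
def HasRealRoots (Δ : ℂ → ℂ) (ls lu : ℝ) : Prop :=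
  ls < 0 ∧ 0 < lu ∧ ∀ x : ℝ, Δ (x : ℂ) = 0 ↔ x = ls ∨ x = lu

end

end NonlocalWave

/-! ### Real zeros of the characteristic function. -/

namespace NonlocalWave

noncomputable section

/-! The deviation `w = 1 - U` is a positive function vanishing at `+∞` with `d w'' - c w' + a w + b
J*w = R`, where Taylor's formula makes `R` quadratic in `w` and `J*w`. The symbol of the linear part
is convex on the real line, equals `a + b < 0` at `0` and grows at least quadratically, so it has
one zero on each side of `0`. Let `-μ` be the negative one.

The sign condition `a + b < 0` gives a maximum principle on half-lines (`nonneg_of_supersolution`).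
Comparison with `e^{-kx}`, `k = 3μ/4`, where the symbol is negative, gives a first decay rate, which
makes `R = O(e^{-3μx/2})`. Barriers built from the rates `μ`, `5μ/4`, `3μ/2` then bound `w` above by
a multiple of `e^{-μx}`, and below by one for large `x` (`exists_le_exp_root`,
`exists_exp_root_le`).

It remains to show that `v = w e^{μx}` converges, not merely stays bounded. Inverting the local part
of the conjugated operator by its Green kernel turns the equation into a renewal equation `v = K*v +
h`, with `K` a probability density and `h` integrable. The mean of `K` is nonzero because the
Laplace transform of `K` at `μ` is less than `1`. The function `flux K v` has derivative `h`, so it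
converges; along sequences realizing the upper or lower limit of `v` it tends to the mean of `K`
times that limit. Hence the two limits agree (`exists_tendsto_of_renewal`), and the lower barrier
makes the common value positive.

The behaviour at `-∞` follows by applying this to the reflected wave `-U(-x)`. -/

/-- The exponential moment `∫ J(s) e^{k s} ds`. -/
def expMoment (J : ℝ → ℝ) (k : ℝ) : ℝ := ∫ s, J s * Real.exp (k * s)

/-- The real restriction of the characteristic function. -/
def symb (d c a b : ℝ) (J : ℝ → ℝ) (x : ℝ) : ℝ :=
  d * x ^ 2 - c * x + a + b * expMoment J (-x)

theorem IsKernel.integrable {J : ℝ → ℝ} (hJ : IsKernel J) : Integrable J := by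
  simpa using hJ.exp_moment 0

theorem expMoment_zero {J : ℝ → ℝ} (hJ : IsKernel J) : expMoment J 0 = 1 := by
  simp [expMoment, hJ.mass_one]

theorem expMoment_neg {J : ℝ → ℝ} (hJ : IsKernel J) (k : ℝ) :
    expMoment J (-k) = expMoment J k := by
  unfold expMoment
  rw [← integral_neg_eq_self]
  simp [hJ.even]

theorem charFn_ofReal (d c a b : ℝ) (J : ℝ → ℝ) (x : ℝ) :
    charFn d c a b J x = (symb d c a b J x : ℂ) := by
  have h : (∫ s : ℝ, (J s : ℂ) * Complex.exp (-(x : ℂ) * s)) = (expMoment J (-x) : ℂ) := by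
    rw [expMoment, ← integral_complex_ofReal]
    congr 1
    ext s
    push_cast
    rfl
  rw [charFn, h, symb]
  push_cast
  ring

theorem two_add_sq_le_exp_add_exp_neg (t : ℝ) :
    2 + t ^ 2 / 2 ≤ Real.exp t + Real.exp (-t) := by
  rcases le_total 0 t with h | h
  · linarith [Real.quadratic_le_exp_of_nonneg h, Real.add_one_le_exp (-t)]
  · have := Real.quadratic_le_exp_of_nonneg (neg_nonneg.2 h)
    nlinarith [Real.add_one_le_exp t]

theorem IsKernel.integrable_sq {J : ℝ → ℝ} (hJ : IsKernel J) :
    Integrable (fun s => J s * s ^ 2) := by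
  refine Integrable.mono' (((hJ.exp_moment 1).add (hJ.exp_moment (-1))).const_mul 2)
    (hJ.continuous.mul (continuous_pow 2)).aestronglyMeasurable (ae_of_all _ fun s => ?_)
  have h := two_add_sq_le_exp_add_exp_neg s
  have h0 := hJ.nonneg s
  rw [Real.norm_of_nonneg (by positivity)]
  simp only [Pi.add_apply, one_mul, neg_mul]
  nlinarith

/-- Otherwise evenness would force `J` to vanish off `0`, contradicting unit mass. This supplies
positivity of `J` on both sides of the origin. -/
theorem IsKernel.exists_neg_pos {J : ℝ → ℝ} (hJ : IsKernel J) : ∃ y < 0, 0 < J y := by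
  by_contra! h
  have h0 : ∀ y, y ≠ 0 → J y = 0 := by
    intro y hy
    rcases lt_or_gt_of_ne hy with h1 | h1
    · exact le_antisymm (h y h1) (hJ.nonneg y)
    · rw [← hJ.even]
      exact le_antisymm (h (-y) (by linarith)) (hJ.nonneg _)
  have h1 : J =ᵐ[volume] 0 := by
    filter_upwards [compl_mem_ae_iff.2 (measure_singleton (0 : ℝ))] with y hy
    exact h0 y hy
  have := hJ.mass_one
  rw [integral_congr_ae h1] at this
  simp at this

theorem integral_pos_of_continuousAt {g : ℝ → ℝ} (hg : ∀ x, 0 ≤ g x) (hi : Integrable g)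
    {x : ℝ} (hc : ContinuousAt g x) (hx : 0 < g x) : 0 < ∫ y, g y := by
  rw [integral_pos_iff_support_of_nonneg hg hi]
  have h : Function.support g ∈ 𝓝 x := by
    filter_upwards [hc.eventually (lt_mem_nhds hx)] with y hy using hy.ne'
  exact Measure.measure_pos_of_mem_nhds volume h

theorem IsKernel.integral_sq_pos {J : ℝ → ℝ} (hJ : IsKernel J) : 0 < ∫ s, J s * s ^ 2 := by
  obtain ⟨y, hy, hJy⟩ := hJ.exists_neg_pos
  exact integral_pos_of_continuousAt (fun s => mul_nonneg (hJ.nonneg s) (sq_nonneg s))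
    hJ.integrable_sq (hJ.continuous.mul (continuous_pow 2)).continuousAt
    (mul_pos hJy (sq_pos_of_neg hy))

/-- Evenness lets `e^{ks}` be replaced by `cosh (ks)`, which is at least `1 + (ks)²/4`; integrate
against `J`. -/
theorem expMoment_growth {J : ℝ → ℝ} (hJ : IsKernel J) (k : ℝ) :
    1 + (∫ s, J s * s ^ 2) / 4 * k ^ 2 ≤ expMoment J k := by
  have h1 : ∫ s, (2 * J s + k ^ 2 / 2 * (J s * s ^ 2)) ≤
      ∫ s, (J s * Real.exp (k * s) + J s * Real.exp (-k * s)) := by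
    refine integral_mono ((hJ.integrable.const_mul 2).add (hJ.integrable_sq.const_mul _))
      ((hJ.exp_moment k).add (hJ.exp_moment (-k))) fun s => ?_
    have h := two_add_sq_le_exp_add_exp_neg (k * s)
    have h0 := hJ.nonneg s
    simp only [neg_mul]
    nlinarith
  rw [integral_add (hJ.integrable.const_mul 2) (hJ.integrable_sq.const_mul _),
    integral_add (hJ.exp_moment k) (hJ.exp_moment (-k)), integral_const_mul, integral_const_mul,
    hJ.mass_one] at h1
  have h2 := expMoment_neg hJ k
  unfold expMoment at h2 ⊢
  linarith

theorem convexOn_symb {d c a b : ℝ} {J : ℝ → ℝ} (hJ : IsKernel J) (hd : 0 ≤ d) (hb : 0 ≤ b) :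
    ConvexOn ℝ Set.univ (symb d c a b J) := by
  refine ⟨convex_univ, fun x _ y _ p r hp hr hpr => ?_⟩
  have h1 : expMoment J (-(p * x + r * y)) ≤ p * expMoment J (-x) + r * expMoment J (-y) := by
    unfold expMoment
    rw [← integral_const_mul, ← integral_const_mul,
      ← integral_add ((hJ.exp_moment _).const_mul _) ((hJ.exp_moment _).const_mul _)]
    refine integral_mono (hJ.exp_moment _)
      (((hJ.exp_moment _).const_mul _).add ((hJ.exp_moment _).const_mul _)) fun s => ?_
    have h := convexOn_exp.2 (Set.mem_univ (-x * s)) (Set.mem_univ (-y * s)) hp hr hpr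
    simp only [smul_eq_mul] at h
    rw [show p * (-x * s) + r * (-y * s) = -(p * x + r * y) * s by ring] at h
    have := mul_le_mul_of_nonneg_left h (hJ.nonneg s)
    linarith
  have h2 : (p * x + r * y) ^ 2 ≤ p * x ^ 2 + r * y ^ 2 := by
    have : r = 1 - p := by linarith
    subst this
    nlinarith [mul_nonneg (mul_nonneg hp hr) (sq_nonneg (x - y))]
  simp only [symb, smul_eq_mul]
  have h3 := mul_le_mul_of_nonneg_left h1 hb
  have h4 := mul_le_mul_of_nonneg_left h2 hd
  have h5 : a = p * a + r * a := by rw [← add_mul, hpr, one_mul]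
  linarith

theorem symb_zero {d c a b : ℝ} {J : ℝ → ℝ} (hJ : IsKernel J) : symb d c a b J 0 = a + b := by
  simp [symb, expMoment_zero hJ]

/-- A convex function that is negative at `0` and vanishes at `z` is negative in between. -/
theorem symb_neg_of_between {d c a b : ℝ} {J : ℝ → ℝ} (hJ : IsKernel J) (hd : 0 ≤ d)
    (hb : 0 ≤ b) (hab : a + b < 0) {z t : ℝ} (hz : symb d c a b J z = 0) (ht0 : 0 ≤ t)
    (ht : t < 1) : symb d c a b J (t * z) < 0 := by
  have h := (convexOn_symb (c := c) (a := a) hJ hd hb).2 (Set.mem_univ 0) (Set.mem_univ z)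
    (sub_nonneg.2 ht.le) ht0 (by ring)
  simp only [smul_eq_mul, mul_zero, zero_add, hz, add_zero, symb_zero hJ] at h
  nlinarith

/-- The zero `z` lies strictly between `0` and `t * z`. Since the value at `0` is negative,
convexity forces a positive value at `t * z`. -/
theorem symb_pos_of_beyond {d c a b : ℝ} {J : ℝ → ℝ} (hJ : IsKernel J) (hd : 0 ≤ d)
    (hb : 0 ≤ b) (hab : a + b < 0) {z t : ℝ} (hz : symb d c a b J z = 0)
    (ht : 1 < t) : 0 < symb d c a b J (t * z) := by
  have ht0 : 0 < t := by linarith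
  have h := (convexOn_symb (c := c) (a := a) hJ hd hb).2 (Set.mem_univ 0)
    (Set.mem_univ (t * z)) (sub_nonneg.2 (inv_le_one_of_one_le₀ ht.le)) (inv_nonneg.2 ht0.le)
    (by ring)
  have h1 : t⁻¹ * (t * z) = z := by field_simp
  simp only [smul_eq_mul, mul_zero, zero_add, h1, hz, symb_zero hJ] at h
  have h2 : t⁻¹ < 1 := inv_lt_one_of_one_lt₀ ht
  have h3 : 0 < t⁻¹ * symb d c a b J (t * z) := by nlinarith
  exact pos_of_mul_pos_right h3 (inv_nonneg.2 ht0.le)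

/-- As `d` may be zero, the quadratic growth has to come from the exponential moment: its
coefficient is `b/4` times the second moment of `J`. -/
theorem exists_symb_pos {d c a b : ℝ} {J : ℝ → ℝ} (hJ : IsKernel J) (hd : 0 ≤ d)
    (hb : 0 < b) : ∃ X > 0, 0 < symb d c a b J X ∧ 0 < symb d c a b J (-X) := by
  set σ := ∫ s, J s * s ^ 2 with hσ
  have hσ0 : 0 < σ := hJ.integral_sq_pos
  set e := b * (σ / 4) with he
  have he0 : 0 < e := by positivity
  have key : ∀ x : ℝ, e * x ^ 2 - c * x + a < symb d c a b J x := by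
    intro x
    have h := mul_le_mul_of_nonneg_left (expMoment_growth hJ (-x)) hb.le
    have h2 : 0 ≤ d * x ^ 2 := by positivity
    simp only [symb]
    nlinarith
  set X := (|c| + |a|) / e + 1 with hX
  have hX1 : 1 ≤ X := by rw [hX]; linarith [show 0 ≤ (|c| + |a|) / e by positivity]
  have hX2 : |c| + |a| ≤ e * X := by
    rw [hX, mul_add, mul_div_cancel₀ _ he0.ne']; linarith
  have hX3 : 0 ≤ e * X ^ 2 - |c| * X - |a| := by
    nlinarith [abs_nonneg a, abs_nonneg c, mul_le_mul_of_nonneg_right hX2 (by linarith : 0 ≤ X)]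
  refine ⟨X, by linarith, lt_of_le_of_lt ?_ (key X), lt_of_le_of_lt ?_ (key (-X))⟩
  · nlinarith [le_abs_self c, neg_abs_le a]
  · nlinarith [neg_abs_le c, neg_abs_le a]

/-- The characteristic function has exactly one negative and one positive real zero. -/
theorem exists_hasRealRoots {d c a b : ℝ} {J : ℝ → ℝ} (hJ : IsKernel J) (hd : 0 ≤ d)
    (hb : 0 < b) (hab : a + b < 0) :
    ∃ ls lu : ℝ, HasRealRoots (charFn d c a b J) ls lu ∧ symb d c a b J ls = 0 ∧
      symb d c a b J lu = 0 := by
  obtain ⟨X, hX, hp, hn⟩ := exists_symb_pos (c := c) (a := a) hJ hd hb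
  have hcont : Continuous (symb d c a b J) :=
    (convexOn_symb hJ hd hb.le).locallyLipschitz.continuous
  have h0 : symb d c a b J 0 < 0 := by rwa [symb_zero hJ]
  obtain ⟨lu, hlu, hlu0⟩ := intermediate_value_Icc hX.le hcont.continuousOn
    (show (0 : ℝ) ∈ Set.Icc _ _ from ⟨h0.le, hp.le⟩)
  obtain ⟨ls, hls, hls0⟩ := intermediate_value_Icc' (neg_nonpos.2 hX.le) hcont.continuousOn
    (show (0 : ℝ) ∈ Set.Icc _ _ from ⟨h0.le, hn.le⟩)
  have hlu1 : 0 < lu := lt_of_le_of_ne hlu.1 fun h => by rw [← h] at hlu0; linarith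
  have hls1 : ls < 0 := lt_of_le_of_ne hls.2 fun h => by rw [h] at hls0; linarith
  -- Write `x = t z` with `t = x / z > 0`: the symbol is negative for `t < 1` and positive for `t >
  -- 1`.
  have uniq : ∀ z x : ℝ, symb d c a b J z = 0 → symb d c a b J x = 0 → 0 < x / z → x = z := by
    intro z x hz hx hxz
    have hz0 : z ≠ 0 := by rintro rfl; simp at hxz
    have hxe : x / z * z = x := by field_simp
    rcases lt_trichotomy (x / z) 1 with h | h | h
    · have := symb_neg_of_between hJ hd hb.le hab hz hxz.le h
      rw [hxe] at this; linarith
    · rw [h] at hxe; linarith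
    · have := symb_pos_of_beyond hJ hd hb.le hab hz h
      rw [hxe] at this; linarith
  refine ⟨ls, lu, ⟨hls1, hlu1, fun x => ?_⟩, hls0, hlu0⟩
  rw [charFn_ofReal, Complex.ofReal_eq_zero]
  constructor
  · intro hx
    rcases lt_trichotomy x 0 with h | h | h
    · exact Or.inl (uniq _ _ hls0 hx (div_pos_of_neg_of_neg h hls1))
    · rw [h] at hx; linarith
    · exact Or.inr (uniq _ _ hlu0 hx (div_pos h hlu1))
  · rintro (rfl | rfl) <;> assumption

end

end NonlocalWave

/-! ### Maximum principle and first exponential decay of tails. -/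

namespace NonlocalWave

noncomputable section

/-- If the second derivative were negative, `x` would also be a local maximum, so `y` would be
locally constant there and its second derivative would vanish. -/
theorem deriv2_nonneg_of_min {y y1 y2 : ℝ → ℝ} (h1 : ∀ x, HasDerivAt y (y1 x) x)
    (h2 : ∀ x, HasDerivAt y1 (y2 x) x) {x : ℝ} (hmin : ∀ z, y x ≤ y z) :
    y1 x = 0 ∧ 0 ≤ y2 x := by
  have hd1 : deriv y = y1 := funext fun z => (h1 z).deriv
  have hd2 : deriv y1 = y2 := funext fun z => (h2 z).deriv
  have hloc : IsLocalMin y x := Eventually.of_forall hmin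
  have hy1 : y1 x = 0 := hloc.hasDerivAt_eq_zero (h1 x)
  refine ⟨hy1, ?_⟩
  by_contra! hneg
  have hmax : IsLocalMax y x :=
    isLocalMax_of_deriv_deriv_neg (by rw [hd1, hd2]; exact hneg) (by rw [hd1]; exact hy1)
      (h1 x).continuousAt
  have hc : y =ᶠ[𝓝 x] fun _ => y x := by
    filter_upwards [hmax] with z hz using le_antisymm hz (hmin z)
  have h := hc.deriv.deriv_eq
  simp only [deriv_const', hd1, hd2] at h
  linarith

/-- The maximum principle for `d ∂² - c ∂ + A + B J*` on a right half-line. -/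
theorem nonneg_of_supersolution {J : ℝ → ℝ} (hJ : IsKernel J) {d c X : ℝ} (hd : 0 ≤ d)
    {y y1 y2 A B : ℝ → ℝ} (h1 : ∀ x, HasDerivAt y (y1 x) x) (h2 : ∀ x, HasDerivAt y1 (y2 x) x)
    (hint : ∀ x, Integrable fun s => J s * y (x - s)) (hleft : ∀ x ≤ X, 0 ≤ y x)
    (hlim : Tendsto y atTop (𝓝 0)) (hAB : ∀ x > X, 0 ≤ B x ∧ A x + B x < 0)
    (hL : ∀ x > X, d * y2 x - c * y1 x + A x * y x + B x * ∫ s, J s * y (x - s) ≤ 0) (x : ℝ) :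
    0 ≤ y x := by
  by_contra! hx
  have hcont : Continuous y := continuous_iff_continuousAt.2 fun z => (h1 z).continuousAt
  -- Beyond `Y` the function exceeds the negative value `y x`, so the minimum over a compact
  -- interval containing `x` is a global one.
  obtain ⟨Y, hY⟩ := eventually_atTop.1 (hlim.eventually (lt_mem_nhds hx))
  have hXx : X < x := by
    by_contra! h
    linarith [hleft x h]
  obtain ⟨z, hz, hzmin⟩ := isCompact_Icc.exists_isMinOn
    (Set.nonempty_Icc.2 (hXx.le.trans (le_max_right Y x))) hcont.continuousOn
  have hzx : y z ≤ y x := hzmin ⟨hXx.le, le_max_right _ _⟩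
  have hmin : ∀ t, y z ≤ y t := by
    intro t
    rcases le_or_gt t X with ht | ht
    · linarith [hleft t ht]
    · rcases le_or_gt t (max Y x) with ht' | ht'
      · exact hzmin ⟨ht.le, ht'⟩
      · exact hzx.trans (hY t ((le_max_left _ _).trans ht'.le)).le
  have hzX : X < z := by
    by_contra! h
    linarith [hleft z h]
  obtain ⟨hz1, hz2⟩ := deriv2_nonneg_of_min h1 h2 hmin
  -- At the global minimum the average is at least `y z`. With `y1 z = 0`, `y2 z ≥ 0` and `B ≥ 0`,
  -- the operator is at least `(A + B) y z > 0`, contradicting `hL`.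
  have hJy : y z ≤ ∫ s, J s * y (z - s) := by
    have h : ∫ s, J s * y z ≤ ∫ s, J s * y (z - s) :=
      integral_mono (hJ.integrable.mul_const _) (hint z) fun s =>
        mul_le_mul_of_nonneg_left (hmin _) (hJ.nonneg s)
    rwa [integral_mul_const, hJ.mass_one, one_mul] at h
  have h := hL z hzX
  obtain ⟨hB, hs⟩ := hAB z hzX
  rw [hz1] at h
  have h3 := mul_le_mul_of_nonneg_left hJy hB
  have h4 := mul_nonneg hd hz2
  nlinarith

theorem integrable_kernel_exp {J : ℝ → ℝ} (hJ : IsKernel J) (k x : ℝ) :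
    Integrable fun s => J s * Real.exp (-k * (x - s)) := by
  refine ((hJ.exp_moment k).mul_const (Real.exp (-k * x))).congr (ae_of_all _ fun s => ?_)
  simp only
  rw [mul_assoc, ← Real.exp_add]
  ring_nf

theorem integral_kernel_exp {J : ℝ → ℝ} (k x : ℝ) :
    ∫ s, J s * Real.exp (-k * (x - s)) = expMoment J k * Real.exp (-k * x) := by
  rw [expMoment, ← integral_mul_const]
  congr 1
  ext s
  rw [mul_assoc, ← Real.exp_add]
  ring_nf

theorem IsKernel.integrable_mul_bounded {J y : ℝ → ℝ} (hJ : IsKernel J) (hy : Continuous y)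
    {B : ℝ} (hB : ∀ x, |y x| ≤ B) (x : ℝ) : Integrable fun s => J s * y (x - s) := by
  refine Integrable.mono' (hJ.integrable.mul_const B)
    (hJ.continuous.mul (hy.comp (continuous_const.sub continuous_id))).aestronglyMeasurable
    (ae_of_all _ fun s => ?_)
  rw [norm_mul, Real.norm_of_nonneg (hJ.nonneg s)]
  exact mul_le_mul_of_nonneg_left (hB _) (hJ.nonneg s)

/-- `w` is a positive bounded solution, vanishing at `+∞`, of
`d w'' - c w' + a w + b J * w = R` with a quadratically small right-hand side. -/
structure IsTail (d c a b C : ℝ) (J w w1 w2 R : ℝ → ℝ) : Prop where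
  kernel : IsKernel J
  d_nonneg : 0 ≤ d
  b_pos : 0 < b
  ab_neg : a + b < 0
  hasDeriv : ∀ x, HasDerivAt w (w1 x) x
  hasDeriv' : ∀ x, HasDerivAt w1 (w2 x) x
  continuous' : Continuous w2
  equation : ∀ x, d * w2 x - c * w1 x + a * w x + b * ∫ s, J s * w (x - s) = R x
  pos : ∀ x, 0 < w x
  le_two : ∀ x, w x ≤ 2
  lim : Tendsto w atTop (𝓝 0)
  C_nonneg : 0 ≤ C
  quadratic : ∀ x, |R x| ≤ C * (w x ^ 2 + (∫ s, J s * w (x - s)) ^ 2)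

variable {d c a b C μ : ℝ} {J w w1 w2 R : ℝ → ℝ}

namespace IsTail

theorem continuous (h : IsTail d c a b C J w w1 w2 R) : Continuous w :=
  continuous_iff_continuousAt.2 fun z => (h.hasDeriv z).continuousAt

theorem abs_le_two (h : IsTail d c a b C J w w1 w2 R) (x : ℝ) : |w x| ≤ 2 := by
  rw [abs_of_pos (h.pos x)]
  exact h.le_two x

theorem integrable (h : IsTail d c a b C J w w1 w2 R) (x : ℝ) :
    Integrable fun s => J s * w (x - s) :=
  h.kernel.integrable_mul_bounded h.continuous h.abs_le_two x

theorem avg_nonneg (h : IsTail d c a b C J w w1 w2 R) (x : ℝ) :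
    0 ≤ ∫ s, J s * w (x - s) :=
  integral_nonneg fun s => mul_nonneg (h.kernel.nonneg s) (h.pos _).le

theorem tendsto_avg (h : IsTail d c a b C J w w1 w2 R) :
    Tendsto (fun x => ∫ s, J s * w (x - s)) atTop (𝓝 0) := by
  have h0 : (∫ s, J s * 0) = (0 : ℝ) := by simp
  rw [← h0]
  refine tendsto_integral_filter_of_dominated_convergence (fun s => J s * 2)
    (Eventually.of_forall fun x => (h.integrable x).aestronglyMeasurable)
    (Eventually.of_forall fun x => ae_of_all _ fun s => ?_) (h.kernel.integrable.mul_const 2)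
    (ae_of_all _ fun s => ?_)
  · rw [norm_mul, Real.norm_of_nonneg (h.kernel.nonneg s)]
    exact mul_le_mul_of_nonneg_left (h.abs_le_two _) (h.kernel.nonneg s)
  · exact (h.lim.comp (tendsto_atTop_add_const_right atTop (-s) tendsto_id)).const_mul (J s)

theorem avg_le_of_le_exp (h : IsTail d c a b C J w w1 w2 R) {M k : ℝ}
    (hM : ∀ x, w x ≤ M * Real.exp (-k * x)) (x : ℝ) :
    ∫ s, J s * w (x - s) ≤ M * expMoment J k * Real.exp (-k * x) := by
  have h1 : ∫ s, J s * w (x - s) ≤ ∫ s, M * (J s * Real.exp (-k * (x - s))) := by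
    refine integral_mono (h.integrable x) ((integrable_kernel_exp h.kernel k x).const_mul M)
      fun s => ?_
    have := mul_le_mul_of_nonneg_left (hM (x - s)) (h.kernel.nonneg s)
    simp only
    linarith
  rwa [integral_const_mul, integral_kernel_exp, ← mul_assoc] at h1

end IsTail

theorem hasDerivAt_exp_neg_mul (k x : ℝ) :
    HasDerivAt (fun x => Real.exp (-k * x)) (-k * Real.exp (-k * x)) x := by
  have := ((hasDerivAt_id x).const_mul (-k)).exp
  simpa [mul_comm] using this

theorem tendsto_exp_neg_mul {k : ℝ} (hk : 0 < k) :
    Tendsto (fun x => Real.exp (-k * x)) atTop (𝓝 0) :=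
  Real.tendsto_exp_atBot.comp (tendsto_id.const_mul_atTop_of_neg (by linarith))

namespace IsTail

/-- First decay estimate, at any rate where the symbol is negative. -/
theorem exists_le_exp (h : IsTail d c a b C J w w1 w2 R) {k : ℝ} (hk : 0 < k)
    (hsymb : symb d c a b J (-k) < 0) : ∃ M, 0 < M ∧ ∀ x, w x ≤ M * Real.exp (-k * x) := by
  have hJ := h.kernel
  set E := expMoment J k with hE
  have hE0 : 0 ≤ E := integral_nonneg fun s => mul_nonneg (hJ.nonneg s) (Real.exp_pos _).le
  -- Far to the right `|R| ≤ θ (w + J*w)`, so the remainder is absorbed by raising both coefficients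
  -- by `θ`. Small `θ` preserves the maximum principle and the supersolution property of `e^{-kx}`.
  obtain ⟨θ, hθ, hθ1, hθ2⟩ : ∃ θ > 0, a + b + 2 * θ < 0 ∧
      symb d c a b J (-k) + θ * (1 + E) < 0 := by
    have t1 : Tendsto (fun θ : ℝ => a + b + 2 * θ) (𝓝[>] 0) (𝓝 (a + b + 2 * 0)) :=
      (Continuous.tendsto (by fun_prop) 0).mono_left nhdsWithin_le_nhds
    have t2 : Tendsto (fun θ : ℝ => symb d c a b J (-k) + θ * (1 + E)) (𝓝[>] 0)
        (𝓝 (symb d c a b J (-k) + 0 * (1 + E))) :=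
      (Continuous.tendsto (by fun_prop) 0).mono_left nhdsWithin_le_nhds
    have e1 := t1.eventually (gt_mem_nhds (show a + b + 2 * 0 < 0 by linarith [h.ab_neg]))
    have e2 := t2.eventually
      (gt_mem_nhds (show symb d c a b J (-k) + 0 * (1 + E) < 0 by linarith))
    obtain ⟨θ, h1, h2, h3⟩ := (e1.and (e2.and self_mem_nhdsWithin)).exists
    exact ⟨θ, h3, h1, h2⟩
  have hCw : Tendsto (fun x => C * w x) atTop (𝓝 0) := by simpa using h.lim.const_mul C
  have hCJ : Tendsto (fun x => C * ∫ s, J s * w (x - s)) atTop (𝓝 0) := by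
    simpa using h.tendsto_avg.const_mul C
  obtain ⟨X, hX⟩ := eventually_atTop.1
    ((hCw.eventually (gt_mem_nhds hθ)).and (hCJ.eventually (gt_mem_nhds hθ)))
  -- With this `M` the barrier is at least `2 ≥ w` on the whole of `(-∞, X]`, as the nonlocal
  -- comparison demands.
  set M := 2 * Real.exp (k * X) with hM
  refine ⟨M, by positivity, fun x => ?_⟩
  have hint : ∀ x, Integrable fun s => J s * (M * Real.exp (-k * (x - s)) - w (x - s)) := by
    intro x
    have := ((integrable_kernel_exp hJ k x).const_mul M).sub (h.integrable x)
    refine this.congr (ae_of_all _ fun s => ?_)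
    simp only [Pi.sub_apply]
    ring
  have hconv : ∀ x, ∫ s, J s * (M * Real.exp (-k * (x - s)) - w (x - s)) =
      M * (E * Real.exp (-k * x)) - ∫ s, J s * w (x - s) := by
    intro x
    rw [hE, ← integral_kernel_exp, ← integral_const_mul,
      ← integral_sub ((integrable_kernel_exp hJ k x).const_mul M) (h.integrable x)]
    congr 1
    ext s
    ring
  have key := nonneg_of_supersolution hJ (c := c) (X := X) h.d_nonneg
    (y := fun x => M * Real.exp (-k * x) - w x)
    (y1 := fun x => M * (-k * Real.exp (-k * x)) - w1 x)
    (y2 := fun x => M * (-k * (-k * Real.exp (-k * x))) - w2 x)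
    (A := fun _ => a + θ) (B := fun _ => b + θ)
    (fun x => ((hasDerivAt_exp_neg_mul k x).const_mul M).sub (h.hasDeriv x))
    (fun x => (((hasDerivAt_exp_neg_mul k x).const_mul (-k)).const_mul M).sub (h.hasDeriv' x))
    hint ?_ ?_ (fun x _ => ⟨by linarith [h.b_pos], by linarith⟩) ?_ x
  · simpa using key
  · intro x hx
    have h1 : 1 ≤ Real.exp (k * X) * Real.exp (-k * x) := by
      rw [← Real.exp_add]
      exact Real.one_le_exp (by nlinarith)
    have h2 := h.le_two x
    rw [hM]
    linarith
  · simpa using ((tendsto_exp_neg_mul hk).const_mul M).sub h.lim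
  · intro x hx
    obtain ⟨b1, b2⟩ := hX x hx.le
    rw [hconv]
    have heq := h.equation x
    have hw := h.pos x
    have hj := h.avg_nonneg x
    have hR := (abs_le.1 (h.quadratic x)).1
    set j := ∫ s, J s * w (x - s)
    set e := Real.exp (-k * x) with he
    have he0 : 0 < e := Real.exp_pos _
    have hs : symb d c a b J (-k) = d * k ^ 2 + c * k + a + b * E := by
      simp only [symb, neg_neg, ← hE]; ring
    have q1 : C * w x ^ 2 ≤ θ * w x := by nlinarith
    have q2 : C * j ^ 2 ≤ θ * j := by nlinarith
    have q3 : M * e * (symb d c a b J (-k) + θ * (1 + E)) ≤ 0 :=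
      mul_nonpos_of_nonneg_of_nonpos (by positivity) hθ2.le
    rw [hs] at q3
    linarith

end IsTail

end

end NonlocalWave

/-! ### Sharp two-sided bounds at the critical rate. -/

namespace NonlocalWave

noncomputable section

variable {d c a b C μ : ℝ} {J w w1 w2 R : ℝ → ℝ}

/-- A combination of three decaying exponentials. -/
def expComb (m n p k₁ k₂ k₃ x : ℝ) : ℝ :=
  m * Real.exp (-k₁ * x) + n * Real.exp (-k₂ * x) + p * Real.exp (-k₃ * x)

theorem hasDerivAt_expComb (m n p k₁ k₂ k₃ x : ℝ) :
    HasDerivAt (expComb m n p k₁ k₂ k₃)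
      (expComb (m * -k₁) (n * -k₂) (p * -k₃) k₁ k₂ k₃ x) x := by
  have := (((hasDerivAt_exp_neg_mul k₁ x).const_mul m).add
    ((hasDerivAt_exp_neg_mul k₂ x).const_mul n)).add ((hasDerivAt_exp_neg_mul k₃ x).const_mul p)
  simp only [← mul_assoc] at this
  exact this

theorem tendsto_expComb (m n p : ℝ) {k₁ k₂ k₃ : ℝ} (h₁ : 0 < k₁) (h₂ : 0 < k₂) (h₃ : 0 < k₃) :
    Tendsto (expComb m n p k₁ k₂ k₃) atTop (𝓝 0) := by
  have := (((tendsto_exp_neg_mul h₁).const_mul m).add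
    ((tendsto_exp_neg_mul h₂).const_mul n)).add ((tendsto_exp_neg_mul h₃).const_mul p)
  simp only [mul_zero, add_zero] at this
  exact this

theorem integrable_kernel_expComb (hJ : IsKernel J) (m n p k₁ k₂ k₃ x : ℝ) :
    Integrable fun s => J s * expComb m n p k₁ k₂ k₃ (x - s) := by
  have := (((integrable_kernel_exp hJ k₁ x).const_mul m).add
    ((integrable_kernel_exp hJ k₂ x).const_mul n)).add
    ((integrable_kernel_exp hJ k₃ x).const_mul p)
  refine this.congr (ae_of_all _ fun s => ?_)
  simp only [Pi.add_apply, expComb]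
  ring

theorem integral_kernel_expComb (hJ : IsKernel J) (m n p k₁ k₂ k₃ x : ℝ) :
    ∫ s, J s * expComb m n p k₁ k₂ k₃ (x - s) =
      expComb (m * expMoment J k₁) (n * expMoment J k₂) (p * expMoment J k₃) k₁ k₂ k₃ x := by
  have h1 := (integrable_kernel_exp hJ k₁ x).const_mul m
  have h2 := (integrable_kernel_exp hJ k₂ x).const_mul n
  have h3 := (integrable_kernel_exp hJ k₃ x).const_mul p
  have h12 : Integrable fun s => m * (J s * Real.exp (-k₁ * (x - s))) +
      n * (J s * Real.exp (-k₂ * (x - s))) := h1.add h2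
  calc ∫ s, J s * expComb m n p k₁ k₂ k₃ (x - s)
      = ∫ s, ((m * (J s * Real.exp (-k₁ * (x - s))) + n * (J s * Real.exp (-k₂ * (x - s)))) +
          p * (J s * Real.exp (-k₃ * (x - s)))) := by
        congr 1
        ext s
        simp only [expComb]
        ring
    _ = _ := by
        rw [integral_add h12 h3, integral_add h1 h2, integral_const_mul,
          integral_const_mul, integral_const_mul, integral_kernel_exp, integral_kernel_exp,
          integral_kernel_exp, expComb]
        ring

theorem expMoment_nonneg (hJ : IsKernel J) (k : ℝ) : 0 ≤ expMoment J k :=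
  integral_nonneg fun s => mul_nonneg (hJ.nonneg s) (Real.exp_pos _).le

/-- A faster exponential is eventually dominated by a slower one. -/
theorem exists_forall_exp_le {A B k l : ℝ} (hA : 0 < A) (hkl : k < l) :
    ∃ X, 0 ≤ X ∧ ∀ x ≥ X, B * Real.exp (-l * x) ≤ A * Real.exp (-k * x) := by
  have h : Tendsto (fun x => B * Real.exp (-(l - k) * x)) atTop (𝓝 0) := by
    simpa using (tendsto_exp_neg_mul (sub_pos.2 hkl)).const_mul B
  obtain ⟨X, hX⟩ := eventually_atTop.1 (h.eventually (gt_mem_nhds hA))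
  refine ⟨max X 0, le_max_right _ _, fun x hx => ?_⟩
  have h1 := (hX x ((le_max_left _ _).trans hx)).le
  have h2 : Real.exp (-l * x) = Real.exp (-(l - k) * x) * Real.exp (-k * x) := by
    rw [← Real.exp_add]
    ring_nf
  rw [h2, ← mul_assoc]
  exact mul_le_mul_of_nonneg_right h1 (Real.exp_pos _).le

namespace IsTail

theorem symb_neg (h : IsTail d c a b C J w w1 w2 R) (hμ0 : symb d c a b J (-μ) = 0) :
    symb d c a b J (-(3 / 4 * μ)) < 0 := by
  have := symb_neg_of_between h.kernel h.d_nonneg h.b_pos.le h.ab_neg hμ0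
    (t := 3 / 4) (by norm_num) (by norm_num)
  rwa [mul_neg] at this

theorem symb_pos (h : IsTail d c a b C J w w1 w2 R) (hμ0 : symb d c a b J (-μ) = 0) {t : ℝ}
    (ht : 1 < t) : 0 < symb d c a b J (-(t * μ)) := by
  have := symb_pos_of_beyond h.kernel h.d_nonneg h.b_pos.le h.ab_neg hμ0 ht
  rwa [mul_neg] at this

/-- The first decay estimate at rate `3μ/4`, squared. Any fraction of `μ` strictly between `1/2` and
`1` would serve: below `1` the symbol is negative, above `1/2` the square decays faster than
`e^{-μx}`. -/
theorem exists_remainder_le_exp (h : IsTail d c a b C J w w1 w2 R) (hμ : 0 < μ)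
    (hμ0 : symb d c a b J (-μ) = 0) :
    ∃ C', 0 ≤ C' ∧ ∀ x, |R x| ≤ C' * Real.exp (-(3 / 2 * μ) * x) := by
  obtain ⟨M, hM, hw⟩ := h.exists_le_exp (k := 3 / 4 * μ) (by positivity) (h.symb_neg hμ0)
  have hj := h.avg_le_of_le_exp hw
  set E := expMoment J (3 / 4 * μ) with hE
  have hE0 : 0 ≤ E := expMoment_nonneg h.kernel _
  have hC := h.C_nonneg
  refine ⟨C * (M ^ 2 + (M * E) ^ 2), by positivity, fun x => (h.quadratic x).trans ?_⟩
  have he : Real.exp (-(3 / 2 * μ) * x) = Real.exp (-(3 / 4 * μ) * x) ^ 2 := by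
    rw [← Real.exp_nat_mul]
    congr 1
    push_cast
    ring
  rw [he, mul_assoc]
  refine mul_le_mul_of_nonneg_left ?_ hC
  have e1 := pow_le_pow_left₀ (h.pos x).le (hw x) 2
  have e2 := pow_le_pow_left₀ (h.avg_nonneg x) (hj x) 2
  rw [mul_pow] at e1 e2
  linarith

/-- The sharp upper bound. -/
theorem exists_le_exp_root (h : IsTail d c a b C J w w1 w2 R) (hμ : 0 < μ)
    (hμ0 : symb d c a b J (-μ) = 0) : ∃ M, 0 < M ∧ ∀ x, w x ≤ M * Real.exp (-μ * x) := by
  have hJ := h.kernel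
  obtain ⟨C', hC', hR⟩ := h.exists_remainder_le_exp hμ hμ0
  -- The barrier is `M e^{-μx} - e^{-ρx} + e^{-ρ'x}` with `μ < ρ < ρ'`. The first term is
  -- annihilated by the operator; the second contributes a negative amount of order `e^{-ρx}`, which
  -- beats the remainder, of order `e^{-ρ'x}`. The third keeps the barrier positive on the negative
  -- axis, where `e^{-ρx}` exceeds `e^{-μx}`.
  have hρ := h.symb_pos hμ0 (t := 5 / 4) (by norm_num)
  set ρ := 5 / 4 * μ with hρd
  set ρ' := 3 / 2 * μ with hρd'
  obtain ⟨X, hX0, hX⟩ := exists_forall_exp_le (B := symb d c a b J (-ρ') + C') hρ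
    (show ρ < ρ' by linarith)
  -- The part `M - 1` dominates `w` on `x ≤ X`; the extra `1` pays for `-e^{-ρx}` when `x ≥ 0`.
  set M := 1 + 2 * Real.exp (μ * X) with hM
  have hMX : 2 * Real.exp (μ * X) = M - 1 := by rw [hM]; ring
  have hpos : ∀ x ≤ X, 2 ≤ (M - 1) * Real.exp (-μ * x) := by
    intro x hx
    rw [← hMX, mul_assoc, ← Real.exp_add]
    have : 1 ≤ Real.exp (μ * X + -μ * x) := Real.one_le_exp (by nlinarith)
    linarith
  have key := nonneg_of_supersolution hJ (c := c) (X := X) h.d_nonneg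
    (y := fun x => expComb M (-1) 1 μ ρ ρ' x - w x)
    (A := fun _ => a) (B := fun _ => b)
    (fun x => (hasDerivAt_expComb _ _ _ _ _ _ x).sub (h.hasDeriv x))
    (fun x => (hasDerivAt_expComb _ _ _ _ _ _ x).sub (h.hasDeriv' x))
    (fun x => ((integrable_kernel_expComb hJ M (-1) 1 μ ρ ρ' x).sub (h.integrable x)).congr
      (ae_of_all _ fun s => (mul_sub _ _ _).symm)) ?_ ?_ (fun x _ => ⟨h.b_pos.le, h.ab_neg⟩) ?_
  · refine ⟨M, by positivity, fun x => ?_⟩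
    rcases le_total 0 x with hx | hx
    · have h1 := key x
      have h2 : Real.exp (-ρ' * x) ≤ Real.exp (-ρ * x) := Real.exp_le_exp.2 (by nlinarith)
      simp only [expComb] at h1
      linarith
    · linarith [h.le_two x, hpos x (hx.trans hX0), Real.exp_pos (-μ * x)]
  · intro x hx
    have h1 := hpos x hx
    have h2 := h.le_two x
    have h3 := Real.exp_pos (-ρ' * x)
    simp only [expComb]
    rcases le_total 0 x with hx0 | hx0
    · have h4 : Real.exp (-ρ * x) ≤ Real.exp (-μ * x) := Real.exp_le_exp.2 (by nlinarith)
      linarith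
    · have h4 : Real.exp (-ρ * x) ≤ Real.exp (-ρ' * x) := Real.exp_le_exp.2 (by nlinarith)
      linarith [Real.exp_pos (-μ * x)]
  · simpa using (tendsto_expComb M (-1) 1 hμ (by positivity : 0 < ρ)
      (by positivity : 0 < ρ')).sub h.lim
  · intro x hx
    have heq := h.equation x
    have h1 := hX x hx.le
    have h2 := (abs_le.1 (hR x)).1
    simp only [mul_sub]
    rw [integral_sub (integrable_kernel_expComb hJ M (-1) 1 μ ρ ρ' x) (h.integrable x),
      integral_kernel_expComb hJ]
    set j := ∫ s, J s * w (x - s)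
    have hs : ∀ k, symb d c a b J (-k) = d * k ^ 2 + c * k + a + b * expMoment J k := by
      intro k
      simp only [symb, neg_neg]
      ring
    rw [hs] at hμ0
    rw [hs ρ, hs ρ'] at h1
    have h3 : (d * μ ^ 2 + c * μ + a + b * expMoment J μ) * (M * Real.exp (-μ * x)) = 0 := by
      rw [hμ0, zero_mul]
    simp only [expComb]
    linarith

/-- The sharp lower bound. -/
theorem exists_exp_root_le (h : IsTail d c a b C J w w1 w2 R) (hμ : 0 < μ)
    (hμ0 : symb d c a b J (-μ) = 0) :
    ∃ ε, 0 < ε ∧ ∀ x, ε * (Real.exp (-μ * x) - 2 * Real.exp (-(3 / 2 * μ) * x)) ≤ w x := by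
  have hJ := h.kernel
  have hC := h.C_nonneg
  obtain ⟨M, hM, hw⟩ := h.exists_le_exp (k := 3 / 4 * μ) (by positivity) (h.symb_neg hμ0)
  have hj := h.avg_le_of_le_exp hw
  have hρ := h.symb_pos hμ0 (t := 5 / 4) (by norm_num)
  have hE0 := expMoment_nonneg hJ (3 / 4 * μ)
  have hE1 := expMoment_nonneg hJ μ
  have hE2 := expMoment_nonneg hJ (5 / 4 * μ)
  have hE3 := expMoment_nonneg hJ (3 / 2 * μ)
  set κ := 3 / 4 * μ with hκd
  set ρ := 5 / 4 * μ with hρd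
  set ρ' := 3 / 2 * μ with hρd'
  -- Chosen so that both `C w` and `C J*w` are at most `T e^{-κx}`. The remainder is then moved into
  -- the coefficients, which become variable.
  set T := C * M * (1 + expMoment J κ) with hT
  have hT0 : 0 ≤ T := by positivity
  set C₂ := (1 + expMoment J μ) + (1 + expMoment J ρ) with hC₂
  have hC₂0 : 0 ≤ C₂ := by positivity
  obtain ⟨X₁, hX₁0, hX₁⟩ := exists_forall_exp_le (B := 2 * symb d c a b J (-ρ') + T * C₂) hρ
    (show ρ < ρ' by linarith)
  obtain ⟨X₂, hX₂0, hX₂⟩ := exists_forall_exp_le (B := T) h.b_pos (show 0 < κ by positivity)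
  -- Beyond `X₁` the gain at rate `ρ` beats all errors at rate `ρ'`; beyond `X₂` the perturbed
  -- coefficient `b - T e^{-κx}` is nonnegative.
  set X := max X₁ X₂ with hX
  have hX0 : 0 ≤ X := hX₁0.trans (le_max_left _ _)
  obtain ⟨z, -, hz⟩ := isCompact_Icc.exists_isMinOn (Set.nonempty_Icc.2 hX0)
    h.continuous.continuousOn
  set ε := w z / 2 with hε
  have hε0 : 0 < ε := half_pos (h.pos z)
  have key := nonneg_of_supersolution hJ (c := c) (X := X) h.d_nonneg
    (y := fun x => w x - ε * expComb 1 1 (-2) μ ρ ρ' x)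
    (A := fun x => a - T * Real.exp (-κ * x)) (B := fun x => b - T * Real.exp (-κ * x))
    (fun x => (h.hasDeriv x).sub ((hasDerivAt_expComb _ _ _ _ _ _ x).const_mul ε))
    (fun x => (h.hasDeriv' x).sub ((hasDerivAt_expComb _ _ _ _ _ _ x).const_mul ε))
    (fun x => ((h.integrable x).sub
      ((integrable_kernel_expComb hJ 1 1 (-2) μ ρ ρ' x).const_mul ε)).congr
      (ae_of_all _ fun s => by simp only [Pi.sub_apply]; ring)) ?_ ?_ ?_ ?_
  · refine ⟨ε, hε0, fun x => ?_⟩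
    have h1 := key x
    have h2 := mul_pos hε0 (Real.exp_pos (-ρ * x))
    simp only [expComb] at h1
    linarith
  · intro x hx
    simp only [expComb]
    have h1 := Real.exp_pos (-ρ' * x)
    rcases le_total 0 x with hx0 | hx0
    · have h2 : w z ≤ w x := hz ⟨hx0, hx⟩
      have h3 : Real.exp (-μ * x) ≤ 1 := Real.exp_le_one_iff.2 (by nlinarith)
      have h4 : Real.exp (-ρ * x) ≤ 1 := Real.exp_le_one_iff.2 (by nlinarith)
      have h5 : ε * (1 * Real.exp (-μ * x) + 1 * Real.exp (-ρ * x) +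
          -2 * Real.exp (-ρ' * x)) ≤ ε * 2 := mul_le_mul_of_nonneg_left (by linarith) hε0.le
      linarith
    · have h3 : Real.exp (-μ * x) ≤ Real.exp (-ρ' * x) := Real.exp_le_exp.2 (by nlinarith)
      have h4 : Real.exp (-ρ * x) ≤ Real.exp (-ρ' * x) := Real.exp_le_exp.2 (by nlinarith)
      have h5 : ε * (1 * Real.exp (-μ * x) + 1 * Real.exp (-ρ * x) +
          -2 * Real.exp (-ρ' * x)) ≤ 0 :=
        mul_nonpos_of_nonneg_of_nonpos hε0.le (by linarith)
      linarith [h.pos x]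
  · simpa using h.lim.sub ((tendsto_expComb 1 1 (-2) hμ (by positivity : 0 < ρ)
      (by positivity : 0 < ρ')).const_mul ε)
  · intro x hx
    have h1 := hX₂ x ((le_max_right _ _).trans hx.le)
    have h2 : 0 ≤ T * Real.exp (-κ * x) := by positivity
    simp only [neg_zero, zero_mul, Real.exp_zero, mul_one] at h1
    exact ⟨by linarith, by linarith [h.ab_neg]⟩
  · intro x hx
    have hx0 : 0 ≤ x := hX0.trans hx.le
    have heq := h.equation x
    have h1 := hX₁ x ((le_max_left _ _).trans hx.le)
    have h2 := (abs_le.1 (h.quadratic x)).2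
    have hconv : ∫ s, J s * (w (x - s) - ε * expComb 1 1 (-2) μ ρ ρ' (x - s)) =
        (∫ s, J s * w (x - s)) - ε * expComb (1 * expMoment J μ) (1 * expMoment J ρ)
          (-2 * expMoment J ρ') μ ρ ρ' x := by
      rw [← integral_kernel_expComb hJ, ← integral_const_mul,
        ← integral_sub (h.integrable x)
          ((integrable_kernel_expComb hJ 1 1 (-2) μ ρ ρ' x).const_mul ε)]
      congr 1
      ext s
      ring
    rw [hconv]
    have hwx := hw x
    have hjx := hj x
    have hw0 := h.pos x
    have hj0 := h.avg_nonneg x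
    set j := ∫ s, J s * w (x - s)
    have hs : ∀ k, symb d c a b J (-k) = d * k ^ 2 + c * k + a + b * expMoment J k := by
      intro k
      simp only [symb, neg_neg]
      ring
    set θ := T * Real.exp (-κ * x) with hθ
    have hθ0 : 0 ≤ θ := by positivity
    have q1 : C * w x ^ 2 ≤ θ * w x := by
      have : C * w x ≤ θ := by
        have := mul_le_mul_of_nonneg_left hwx hC
        have h5 : 0 ≤ C * M * expMoment J κ * Real.exp (-κ * x) := by positivity
        rw [hθ, hT]
        linarith
      linarith [mul_le_mul_of_nonneg_right this hw0.le]
    have q2 : C * j ^ 2 ≤ θ * j := by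
      have : C * j ≤ θ := by
        have := mul_le_mul_of_nonneg_left hjx hC
        have h5 : 0 ≤ C * M * Real.exp (-κ * x) := by positivity
        rw [hθ, hT]
        linarith
      linarith [mul_le_mul_of_nonneg_right this hj0]
    -- The cost of perturbing the coefficients has rate `κ + μ = 7μ/4`, faster than `ρ' = 3μ/2`.
    have q3 : θ * (expComb 1 1 (-2) μ ρ ρ' x + expComb (1 * expMoment J μ) (1 * expMoment J ρ)
          (-2 * expMoment J ρ') μ ρ ρ' x) ≤ T * C₂ * Real.exp (-ρ' * x) := by
      have h4 : Real.exp (-ρ * x) ≤ Real.exp (-μ * x) := Real.exp_le_exp.2 (mul_le_mul_of_nonneg_right (by linarith) hx0)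
      have h5 : Real.exp (-κ * x) * Real.exp (-μ * x) ≤ Real.exp (-ρ' * x) := by
        rw [← Real.exp_add]
        rw [← add_mul]
        exact Real.exp_le_exp.2 (mul_le_mul_of_nonneg_right (by linarith) hx0)
      have h6 : expComb 1 1 (-2) μ ρ ρ' x + expComb (1 * expMoment J μ) (1 * expMoment J ρ)
          (-2 * expMoment J ρ') μ ρ ρ' x ≤ C₂ * Real.exp (-μ * x) := by
        have h7 : 0 ≤ (1 + expMoment J ρ') * Real.exp (-ρ' * x) := by positivity
        have h8 := mul_le_mul_of_nonneg_left h4 (by positivity : 0 ≤ 1 + expMoment J ρ)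
        simp only [expComb, hC₂]
        linarith
      calc _ ≤ θ * (C₂ * Real.exp (-μ * x)) := mul_le_mul_of_nonneg_left h6 hθ0
        _ = T * C₂ * (Real.exp (-κ * x) * Real.exp (-μ * x)) := by rw [hθ]; ring
        _ ≤ _ := mul_le_mul_of_nonneg_left h5 (by positivity)
    rw [hs] at hμ0
    rw [hs ρ, hs ρ'] at h1
    have q4 : 0 ≤ ε * ((d * ρ ^ 2 + c * ρ + a + b * expMoment J ρ) * Real.exp (-ρ * x) -
        2 * (d * ρ' ^ 2 + c * ρ' + a + b * expMoment J ρ') * Real.exp (-ρ' * x) -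
        θ * (expComb 1 1 (-2) μ ρ ρ' x + expComb (1 * expMoment J μ) (1 * expMoment J ρ)
          (-2 * expMoment J ρ') μ ρ ρ' x)) := mul_nonneg hε0.le (by linarith)
    have q5 : (d * μ ^ 2 + c * μ + a + b * expMoment J μ) * (ε * Real.exp (-μ * x)) = 0 := by
      rw [hμ0, zero_mul]
    simp only [expComb] at q4 ⊢
    linarith

end IsTail

end

end NonlocalWave

/-! ### A renewal theorem on the line. -/

namespace NonlocalWave

noncomputable section

/-- The flux `∫ K(s) (∫_{x-s}^{x} v) ds`. -/
def flux (K v : ℝ → ℝ) (x : ℝ) : ℝ := ∫ s, K s * ∫ y in (0 : ℝ)..s, v (x - y)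

/-- In terms of a primitive of `v`, the dependence on `x` becomes visibly differentiable; this is
what allows the flux to be differentiated under the integral sign. -/
theorem integral_flip (v : ℝ → ℝ) (hv : Continuous v) (x s : ℝ) :
    ∫ y in (0 : ℝ)..s, v (x - y) = (∫ y in (0 : ℝ)..x, v y) - ∫ y in (0 : ℝ)..(x - s), v y := by
  rw [intervalIntegral.integral_comp_sub_left, sub_zero,
    intervalIntegral.integral_interval_sub_left (hv.intervalIntegrable _ _)
      (hv.intervalIntegrable _ _)]

theorem abs_integral_flip_le {v : ℝ → ℝ} {B : ℝ} (hB : ∀ x, |v x| ≤ B) (x s : ℝ) :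
    |∫ y in (0 : ℝ)..s, v (x - y)| ≤ B * |s| := by
  have := intervalIntegral.norm_integral_le_of_norm_le_const (a := (0 : ℝ)) (b := s)
    (f := fun y => v (x - y)) (C := B) fun y _ => hB _
  simpa using this

theorem continuous_integral_flip {v : ℝ → ℝ} (hv : Continuous v) (x : ℝ) :
    Continuous fun s => ∫ y in (0 : ℝ)..s, v (x - y) :=
  intervalIntegral.continuous_primitive
    (fun a b => (hv.comp (continuous_const.sub continuous_id)).intervalIntegrable a b) 0

section

variable {K v h : ℝ → ℝ} {B : ℝ}

theorem integrable_kernel_mul (hK : Integrable K) (hv : Continuous v) (hB : ∀ x, |v x| ≤ B)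
    (x : ℝ) : Integrable fun s => K s * v (x - s) :=
  hK.mul_bdd (c := B) (hv.comp (continuous_const.sub continuous_id)).aestronglyMeasurable
    (ae_of_all _ fun _ => hB _)

theorem integrable_flux (hK : Integrable K) (hsK : Integrable fun s => s * K s)
    (hv : Continuous v) (hB : ∀ x, |v x| ≤ B) (x : ℝ) :
    Integrable fun s => K s * ∫ y in (0 : ℝ)..s, v (x - y) := by
  refine Integrable.mono' (hsK.norm.const_mul B)
    (hK.aestronglyMeasurable.mul (continuous_integral_flip hv x).aestronglyMeasurable)
    (ae_of_all _ fun s => ?_)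
  rw [norm_mul, norm_mul]
  have := mul_le_mul_of_nonneg_left (abs_integral_flip_le hB x s) (norm_nonneg (K s))
  simp only [Real.norm_eq_abs] at this ⊢
  linarith

theorem hasDerivAt_flux (hK : Integrable K) (hsK : Integrable fun s => s * K s)
    (hv : Continuous v) (hB : ∀ x, |v x| ≤ B) (x : ℝ) :
    HasDerivAt (flux K v) (∫ s, K s * (v x - v (x - s))) x := by
  have hW : ∀ x, HasDerivAt (fun x => ∫ y in (0 : ℝ)..x, v y) (v x) x := fun x =>
    intervalIntegral.integral_hasDerivAt_right (hv.intervalIntegrable _ _)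
      (hv.stronglyMeasurableAtFilter _ _) hv.continuousAt
  refine (hasDerivAt_integral_of_dominated_loc_of_deriv_le (μ := volume)
    (F := fun x s => K s * ∫ y in (0 : ℝ)..s, v (x - y))
    (F' := fun x s => K s * (v x - v (x - s))) (bound := fun s => ‖K s‖ * (2 * B))
    univ_mem
    (Eventually.of_forall fun z => (integrable_flux hK hsK hv hB z).aestronglyMeasurable)
    (integrable_flux hK hsK hv hB x)
    (hK.aestronglyMeasurable.mul
      (continuous_const.sub (hv.comp (continuous_const.sub continuous_id))).aestronglyMeasurable)
    (ae_of_all _ fun s z _ => ?_) (hK.norm.mul_const _)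
    (ae_of_all _ fun s z _ => ?_)).2
  · rw [norm_mul]
    refine mul_le_mul_of_nonneg_left ((norm_sub_le _ _).trans ?_) (norm_nonneg _)
    have h1 := hB z
    have h2 := hB (z - s)
    simp only [Real.norm_eq_abs]
    linarith
  · simp only [integral_flip v hv]
    refine HasDerivAt.const_mul _ ((hW z).sub ?_)
    exact (hW (z - s)).comp_sub_const z s

/-- Since `K` has mass one, the derivative of the flux is `v - K*v = h`, which is integrable at
`+∞`. -/
theorem exists_tendsto_flux (hK : Integrable K) (hK1 : ∫ s, K s = 1)
    (hsK : Integrable fun s => s * K s) (hv : Continuous v) (hB : ∀ x, |v x| ≤ B)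
    (hh : ∀ x, v x - ∫ s, K s * v (x - s) = h x) (hint : IntegrableOn h (Set.Ioi 0)) :
    ∃ H, Tendsto (flux K v) atTop (𝓝 H) := by
  refine ⟨_, tendsto_limUnder_of_hasDerivAt_of_integrableOn_Ioi (a := 0) (f' := h)
    (fun x _ => ?_) hint⟩
  have := hasDerivAt_flux hK hsK hv hB x
  simp only [mul_sub] at this
  rwa [integral_sub (hK.mul_const _) (integrable_kernel_mul hK hv hB x), integral_mul_const,
    hK1, one_mul, hh] at this

/-- Along a sequence realizing the upper limit, `v` becomes locally constant where `K > 0`. -/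
theorem exists_subseq_ae_tendsto (hK0 : ∀ s, 0 ≤ K s) (hK : Integrable K) (hK1 : ∫ s, K s = 1)
    (hv : Continuous v) (hB : ∀ x, |v x| ≤ B) (hh : ∀ x, v x - ∫ s, K s * v (x - s) = h x)
    (hh0 : Tendsto h atTop (𝓝 0)) {S : ℝ} (hS : ∀ ε > 0, ∀ᶠ x in atTop, v x < S + ε)
    {u : ℕ → ℝ} (hu : Tendsto u atTop atTop) (hvu : Tendsto (fun n => v (u n)) atTop (𝓝 S)) :
    ∃ ns : ℕ → ℕ, StrictMono ns ∧
      ∀ᵐ s, K s ≠ 0 → Tendsto (fun n => v (u (ns n) - s)) atTop (𝓝 S) := by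
  have hvm : ∀ n, AEStronglyMeasurable (fun s => v (u n - s)) volume := fun n =>
    (hv.comp (continuous_const.sub continuous_id)).aestronglyMeasurable
  -- As `S` bounds the upper limit of `v`, positive parts of `v - S` vanish at `+∞`, and dominated
  -- convergence applies.
  have hpos : Tendsto (fun n => ∫ s, K s * max (v (u n - s) - S) 0) atTop (𝓝 0) := by
    suffices h0 : Tendsto (fun n => ∫ s, K s * max (v (u n - s) - S) 0) atTop
        (𝓝 (∫ s, K s * 0)) by simpa only [mul_zero, integral_zero] using h0
    refine tendsto_integral_filter_of_dominated_convergence (fun s => K s * (B + |S|))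
      (Eventually.of_forall fun n => hK.aestronglyMeasurable.mul
        (((hv.comp (continuous_const.sub continuous_id)).sub continuous_const).max
          continuous_const).aestronglyMeasurable)
      (Eventually.of_forall fun n => ae_of_all _ fun s => ?_) (hK.mul_const _)
      (ae_of_all _ fun s => Tendsto.const_mul _ ?_)
    · rw [norm_mul, Real.norm_of_nonneg (hK0 s), Real.norm_of_nonneg (le_max_right _ _)]
      refine mul_le_mul_of_nonneg_left (max_le ?_ ?_) (hK0 s)
      · linarith [(abs_le.1 (hB (u n - s))).2, neg_abs_le S]
      · linarith [(abs_nonneg _).trans (hB 0), abs_nonneg S]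
    · rw [Metric.tendsto_atTop']
      intro ε hε
      have hus : Tendsto (fun n => u n - s) atTop atTop :=
        tendsto_atTop_add_const_right atTop (-s) hu
      obtain ⟨N, hN⟩ := eventually_atTop.1 (hus.eventually (hS ε hε))
      refine ⟨N, fun n hn => ?_⟩
      rw [Real.dist_eq, sub_zero, abs_of_nonneg (le_max_right _ _)]
      exact max_lt (by linarith [hN n hn.le]) hε
  have hKv := fun x => integrable_kernel_mul hK hv hB x
  have hG : ∀ n, Integrable fun s => K s * |v (u n - s) - S| := fun n =>
    hK.mul_bdd (c := B + |S|) ((hvm n).sub aestronglyMeasurable_const).norm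
      (ae_of_all _ fun s => by
        rw [Real.norm_eq_abs, abs_abs]
        exact (abs_sub _ _).trans (by linarith [hB (u n - s)]))
  -- Use `|t| = 2 t⁺ - t`: by the equation, the `K`-average of `v (u n - s) - S` is `v (u n) - h (u
  -- n) - S`, which tends to `0`. A subsequence then converges almost everywhere.
  have hL1 : Tendsto (fun n => ∫ s, K s * |v (u n - s) - S|) atTop (𝓝 0) := by
    have e : ∀ n, ∫ s, K s * |v (u n - s) - S| =
        S - v (u n) + h (u n) + 2 * ∫ s, K s * max (v (u n - s) - S) 0 := by
      intro n
      have h1 : ∀ s, K s * max (v (u n - s) - S) 0 =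
          2⁻¹ * (K s * |v (u n - s) - S| + (K s * v (u n - s) - K s * S)) := by
        intro s
        rcases le_total 0 (v (u n - s) - S) with h | h
        · rw [max_eq_left h, abs_of_nonneg h]; ring
        · rw [max_eq_right h, abs_of_nonpos h]; ring
      simp only [h1]
      have h2 : Integrable fun s => K s * v (u n - s) - K s * S :=
        (hKv (u n)).sub (hK.mul_const S)
      rw [integral_const_mul, integral_add (hG n) h2,
        integral_sub (hKv (u n)) (hK.mul_const S), integral_mul_const, hK1]
      linarith [hh (u n)]
    simp only [e]
    have := ((tendsto_const_nhds (x := S)).sub hvu).add (hh0.comp hu) |>.add (hpos.const_mul 2)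
    simpa using this
  have hmeas : TendstoInMeasure volume (fun n s => K s * |v (u n - s) - S|) atTop
      (fun _ => 0) := by
    refine tendstoInMeasure_of_tendsto_eLpNorm_of_ne_top one_ne_zero ENNReal.one_ne_top
      (fun n => (hG n).aestronglyMeasurable) aestronglyMeasurable_const ?_
    have e : ∀ n, eLpNorm ((fun s => K s * |v (u n - s) - S|) - fun _ => 0) 1 volume =
        ENNReal.ofReal (∫ s, K s * |v (u n - s) - S|) := by
      intro n
      rw [show ((fun s => K s * |v (u n - s) - S|) - fun _ => (0 : ℝ)) =
          fun s => K s * |v (u n - s) - S| from sub_zero _,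
        eLpNorm_one_eq_lintegral_enorm, ← ofReal_integral_norm_eq_lintegral_enorm (hG n)]
      congr 2
      ext s
      exact Real.norm_of_nonneg (mul_nonneg (hK0 s) (abs_nonneg _))
    simp only [e]
    simpa using ENNReal.tendsto_ofReal hL1
  obtain ⟨ns, hns, hae⟩ := hmeas.exists_seq_tendsto_ae
  refine ⟨ns, hns, hae.mono fun s hs hKs => ?_⟩
  have h1 := hs.const_mul (K s)⁻¹
  simp only [mul_zero, inv_mul_cancel_left₀ hKs] at h1
  exact tendsto_iff_norm_sub_tendsto_zero.2 h1

/-- Take `S` to be the upper limit of `v`. Along a suitable sequence `v` is asymptotically equal to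
`S` wherever `K` charges, so the flux tends there to the mean of `K` times `S`. -/
theorem exists_upper_limit_of_renewal (hK0 : ∀ s, 0 ≤ K s) (hK : Integrable K)
    (hK1 : ∫ s, K s = 1) (hsK : Integrable fun s => s * K s)
    (hconn : ∀ s, K s ≠ 0 → ∀ t ∈ Set.uIcc 0 s, K t ≠ 0)
    (hv : Continuous v) (hB : ∀ x, |v x| ≤ B) (hh : ∀ x, v x - ∫ s, K s * v (x - s) = h x)
    (hh0 : Tendsto h atTop (𝓝 0)) {H : ℝ} (hH : Tendsto (flux K v) atTop (𝓝 H)) :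
    ∃ S, (∀ ε > 0, ∀ᶠ x in atTop, v x < S + ε) ∧ H = (∫ s, s * K s) * S := by
  have hbdd : IsBoundedUnder (· ≤ ·) atTop v := isBoundedUnder_of ⟨B, fun x => (abs_le.1 (hB x)).2⟩
  have hbdd' : IsBoundedUnder (· ≥ ·) atTop v :=
    isBoundedUnder_of ⟨-B, fun x => (abs_le.1 (hB x)).1⟩
  set S := limsup v atTop with hSd
  have hS : ∀ ε > 0, ∀ᶠ x in atTop, v x < S + ε := fun ε hε =>
    eventually_lt_of_limsup_lt (lt_add_of_pos_right S hε) hbdd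
  refine ⟨S, hS, ?_⟩
  have hfreq : ∀ n : ℕ, ∃ x : ℝ, (n : ℝ) ≤ x ∧ S - 1 / ((n : ℝ) + 1) < v x := by
    intro n
    have h1 : ∃ᶠ x in atTop, S - 1 / ((n : ℝ) + 1) < v x :=
      frequently_lt_of_lt_limsup hbdd'.isCoboundedUnder_le
        (sub_lt_self S (by positivity))
    obtain ⟨x, hx1, hx2⟩ := (h1.and_eventually (eventually_ge_atTop (n : ℝ))).exists
    exact ⟨x, hx2, hx1⟩
  choose u hu1 hu2 using hfreq
  have hu : Tendsto u atTop atTop := tendsto_atTop_mono hu1 tendsto_natCast_atTop_atTop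
  have hvu : Tendsto (fun n => v (u n)) atTop (𝓝 S) := by
    rw [tendsto_order]
    constructor
    · intro r hr
      have h1 : Tendsto (fun n : ℕ => S - 1 / ((n : ℝ) + 1)) atTop (𝓝 (S - 0)) :=
        tendsto_const_nhds.sub tendsto_one_div_add_atTop_nhds_zero_nat
      rw [sub_zero] at h1
      filter_upwards [h1.eventually (lt_mem_nhds hr)] with n hn using hn.trans (hu2 n)
    · intro r hr
      filter_upwards [hu.eventually (hS (r - S) (sub_pos.2 hr))] with n hn
      linarith
  obtain ⟨ns, hns, hae⟩ := exists_subseq_ae_tendsto hK0 hK hK1 hv hB hh hh0 hS hu hvu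
  -- The inner integral runs over all points between `0` and `s`; `hconn` keeps them in the set
  -- where convergence is known.
  have hinner : ∀ s, K s ≠ 0 → Tendsto (fun n => ∫ y in (0 : ℝ)..s, v (u (ns n) - y)) atTop
      (𝓝 (s * S)) := by
    intro s hs
    have e : s * S = ∫ _ in (0 : ℝ)..s, S := by simp
    rw [e]
    refine intervalIntegral.tendsto_integral_filter_of_dominated_convergence (fun _ => B)
      (Eventually.of_forall fun n =>
        (hv.comp (continuous_const.sub continuous_id)).aestronglyMeasurable)
      (Eventually.of_forall fun n => ae_of_all _ fun y _ => hB _) intervalIntegrable_const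
      (hae.mono fun y hy hys => hy (hconn s hs y (Set.uIoc_subset_uIcc hys)))
  have hlim : Tendsto (fun n => flux K v (u (ns n))) atTop (𝓝 (∫ s, K s * (s * S))) := by
    refine tendsto_integral_filter_of_dominated_convergence (fun s => B * ‖s * K s‖)
      (Eventually.of_forall fun n => (integrable_flux hK hsK hv hB _).aestronglyMeasurable)
      (Eventually.of_forall fun n => ae_of_all _ fun s => ?_) (hsK.norm.const_mul B)
      (ae_of_all _ fun s => ?_)
    · rw [norm_mul, norm_mul]
      have := mul_le_mul_of_nonneg_left (abs_integral_flip_le hB (u (ns n)) s) (norm_nonneg (K s))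
      simp only [Real.norm_eq_abs] at this ⊢
      linarith
    · by_cases hs : K s = 0
      · simp [hs]
      · exact (hinner s hs).const_mul (K s)
  have h1 := tendsto_nhds_unique hlim (hH.comp (hu.comp hns.tendsto_atTop))
  rw [← h1, ← integral_mul_const]
  congr 1
  ext s
  ring

/-- A renewal theorem: bounded solutions of `v = K * v + h` with nonzero drift converge. -/
theorem exists_tendsto_of_renewal (hK0 : ∀ s, 0 ≤ K s) (hK : Integrable K)
    (hK1 : ∫ s, K s = 1) (hsK : Integrable fun s => s * K s) (hm : ∫ s, s * K s ≠ 0)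
    (hconn : ∀ s, K s ≠ 0 → ∀ t ∈ Set.uIcc 0 s, K t ≠ 0)
    (hv : Continuous v) (hB : ∀ x, |v x| ≤ B) (hh : ∀ x, v x - ∫ s, K s * v (x - s) = h x)
    (hint : IntegrableOn h (Set.Ioi 0)) (hh0 : Tendsto h atTop (𝓝 0)) :
    ∃ D, Tendsto v atTop (𝓝 D) := by
  obtain ⟨H, hH⟩ := exists_tendsto_flux hK hK1 hsK hv hB hh hint
  obtain ⟨S, hS, hHS⟩ := exists_upper_limit_of_renewal hK0 hK hK1 hsK hconn hv hB hh hh0 hH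
  -- Applied to `-v`, so that `-S'` plays the role of the lower limit; the nonzero mean then
  -- identifies it with `S`.
  obtain ⟨S', hS', hHS'⟩ := exists_upper_limit_of_renewal (v := fun x => -v x)
    (h := fun x => -h x) (H := -H) hK0 hK hK1 hsK hconn hv.neg (fun x => by simpa using hB x)
    (fun x => by simp only [mul_neg, integral_neg]; linarith [hh x]) (by simpa using hh0.neg)
    (hH.neg.congr fun x => by simp only [flux, intervalIntegral.integral_neg, mul_neg, integral_neg])
  have hSS : S' = -S := by
    have : (∫ s, s * K s) * (S' + S) = 0 := by linarith
    rcases mul_eq_zero.1 this with h | h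
    · exact absurd h hm
    · linarith
  refine ⟨S, ?_⟩
  rw [tendsto_order]
  constructor
  · intro r hr
    filter_upwards [hS' (S - r) (sub_pos.2 hr)] with x hx
    linarith
  · intro r hr
    filter_upwards [hS (r - S) (sub_pos.2 hr)] with x hx
    linarith

end

end

end NonlocalWave

/-! ### Green kernel of the local operator. -/

namespace NonlocalWave

noncomputable section

/-- The two-sided exponential kernel. -/
def green (p p' α β t : ℝ) : ℝ :=
  if 0 < t then p * Real.exp (α * t) else p' * Real.exp (β * t)

theorem integrable_of_Iic_of_Ioi {g : ℝ → ℝ} (h1 : IntegrableOn g (Set.Iic 0))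
    (h2 : IntegrableOn g (Set.Ioi 0)) : Integrable g := by
  rw [← integrableOn_univ, ← Set.Iic_union_Ioi (a := (0 : ℝ))]
  exact h1.union h2

section

variable {p p' α β : ℝ}

theorem green_of_pos {t : ℝ} (ht : 0 < t) : green p p' α β t = p * Real.exp (α * t) := if_pos ht

theorem green_of_nonpos {t : ℝ} (ht : t ≤ 0) : green p p' α β t = p' * Real.exp (β * t) :=
  if_neg ht.not_gt

theorem measurable_green : Measurable (green p p' α β) :=
  Measurable.ite measurableSet_Ioi (by fun_prop) (by fun_prop)

theorem green_nonneg (hp : 0 ≤ p) (hp' : 0 ≤ p') (t : ℝ) : 0 ≤ green p p' α β t := by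
  unfold green
  split_ifs <;> positivity

theorem green_le (hp : 0 ≤ p) (hp' : 0 ≤ p') (hα : α < 0) (hβ : 0 < β) (t : ℝ) :
    green p p' α β t ≤ p + p' := by
  rcases lt_or_ge 0 t with h | h
  · rw [green_of_pos h]
    have : Real.exp (α * t) ≤ 1 := Real.exp_le_one_iff.2 (by nlinarith)
    nlinarith
  · rw [green_of_nonpos h]
    have : Real.exp (β * t) ≤ 1 := Real.exp_le_one_iff.2 (by nlinarith)
    nlinarith

theorem continuousAt_green {t : ℝ} (ht : t ≠ 0) : ContinuousAt (green p p' α β) t := by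
  rcases lt_or_gt_of_ne ht with h | h
  · have h1 : ContinuousAt (fun t => p' * Real.exp (β * t)) t := by fun_prop
    refine h1.congr ?_
    filter_upwards [gt_mem_nhds h] with z hz using (green_of_nonpos hz.le).symm
  · have h1 : ContinuousAt (fun t => p * Real.exp (α * t)) t := by fun_prop
    refine h1.congr ?_
    filter_upwards [lt_mem_nhds h] with z hz using (green_of_pos hz).symm

theorem integral_green_mul {φ : ℝ → ℝ}
    (hi : Integrable fun t => green p p' α β t * φ t) :
    ∫ t, green p p' α β t * φ t = p' * (∫ t in Set.Iic 0, Real.exp (β * t) * φ t) +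
      p * ∫ t in Set.Ioi 0, Real.exp (α * t) * φ t := by
  rw [← intervalIntegral.integral_Iic_add_Ioi (b := 0) hi.integrableOn hi.integrableOn,
    ← integral_const_mul, ← integral_const_mul]
  congr 1
  · refine setIntegral_congr_fun measurableSet_Iic fun t ht => ?_
    simp only [green_of_nonpos (Set.mem_Iic.1 ht)]
    ring
  · refine setIntegral_congr_fun measurableSet_Ioi fun t ht => ?_
    simp only [green_of_pos (Set.mem_Ioi.1 ht)]
    ring

theorem integrable_green_mul_exp {x : ℝ} (hα : α < x) (hβ : x < β) :
    Integrable fun t => green p p' α β t * Real.exp (-x * t) := by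
  refine integrable_of_Iic_of_Ioi ?_ ?_
  · have := (integrableOn_exp_mul_Iic (sub_pos.2 hβ) 0).const_mul p'
    refine IntegrableOn.congr_fun this (fun t ht => ?_) measurableSet_Iic
    simp only [green_of_nonpos (Set.mem_Iic.1 ht)]
    rw [mul_assoc, ← Real.exp_add]
    ring_nf
  · have := (integrableOn_exp_mul_Ioi (sub_neg.2 hα) 0).const_mul p
    refine IntegrableOn.congr_fun this (fun t ht => ?_) measurableSet_Ioi
    simp only [green_of_pos (Set.mem_Ioi.1 ht)]
    rw [mul_assoc, ← Real.exp_add]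
    ring_nf

theorem integral_green_mul_exp {x : ℝ} (hα : α < x) (hβ : x < β) :
    ∫ t, green p p' α β t * Real.exp (-x * t) = p / (x - α) + p' / (β - x) := by
  rw [integral_green_mul (integrable_green_mul_exp hα hβ)]
  simp only [← Real.exp_add, ← add_mul]
  rw [integral_exp_mul_Iic (by linarith), integral_exp_mul_Ioi (by linarith)]
  have h1 : β + -x ≠ 0 := by linarith
  have h2 : α + -x ≠ 0 := by linarith
  have h3 : β - x ≠ 0 := by linarith
  have h4 : x - α ≠ 0 := by linarith
  simp only [mul_zero, Real.exp_zero]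
  rw [show α + -x = -(x - α) by ring, show β + -x = β - x by ring]
  field_simp
  ring

theorem integrable_green (hα : α < 0) (hβ : 0 < β) : Integrable (green p p' α β) := by
  simpa using integrable_green_mul_exp (p := p) (p' := p') hα hβ

end

/-- Inversion of the local operator `c ∂ - d ∂² - a` by a one-sided exponential. -/
theorem integral_exp_mul_operator {d c a α B B' : ℝ} {y y1 y2 : ℝ → ℝ} (hα : α < 0)
    (hroot : d * α ^ 2 - c * α + a = 0) (h1 : ∀ x, HasDerivAt y (y1 x) x)
    (h2 : ∀ x, HasDerivAt y1 (y2 x) x) (hy2 : Continuous y2) (hB : ∀ x, |y x| ≤ B)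
    (hB' : ∀ x, |c * y1 x - d * y2 x - a * y x| ≤ B') (x : ℝ) :
    ∫ t in Set.Ioi (0 : ℝ), Real.exp (α * t) *
      (c * y1 (x - t) - d * y2 (x - t) - a * y (x - t)) = (c - α * d) * y x - d * y1 x := by
  have hy : Continuous y := continuous_iff_continuousAt.2 fun z => (h1 z).continuousAt
  have hy1 : Continuous y1 := continuous_iff_continuousAt.2 fun z => (h2 z).continuousAt
  set φ : ℝ → ℝ := fun t => Real.exp (α * t) *
    (c * y1 (x - t) - d * y2 (x - t) - a * y (x - t)) with hφ
  set F : ℝ → ℝ := fun t => Real.exp (α * t) * ((α * d - c) * y (x - t) + d * y1 (x - t)) with hF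
  have hφc : Continuous φ := by fun_prop
  have hint : IntegrableOn φ (Set.Ioi 0) := by
    refine Integrable.mono' ((integrableOn_exp_mul_Ioi hα 0).mul_const B')
      hφc.aestronglyMeasurable (ae_of_all _ fun t => ?_)
    rw [norm_mul, Real.norm_of_nonneg (Real.exp_pos _).le]
    exact mul_le_mul_of_nonneg_left (hB' _) (Real.exp_pos _).le
  -- The root condition on `α` is exactly what makes the integrand an exact derivative.
  have hFd : ∀ t, HasDerivAt F (φ t) t := by
    intro t
    have e1 : HasDerivAt (fun t => Real.exp (α * t)) (Real.exp (α * t) * α) t := by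
      simpa using ((hasDerivAt_id t).const_mul α).exp
    have e2 : HasDerivAt (fun t => y (x - t)) (-y1 (x - t)) t :=
      (h1 (x - t)).comp_const_sub x t
    have e3 : HasDerivAt (fun t => y1 (x - t)) (-y2 (x - t)) t :=
      (h2 (x - t)).comp_const_sub x t
    have e4 := e1.mul ((e2.const_mul (α * d - c)).add (e3.const_mul d))
    refine e4.congr_deriv ?_
    have : a = c * α - d * α ^ 2 := by linarith
    simp only [hφ, Pi.add_apply, this]
    ring
  have hFTC : ∀ T, ∫ t in (0 : ℝ)..T, φ t = F T - F 0 := fun T =>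
    intervalIntegral.integral_eq_sub_of_hasDerivAt (fun t _ => hFd t)
      (hφc.intervalIntegrable _ _)
  -- No bound on `y1` is assumed. The mean value theorem on unit intervals gives a sequence tending
  -- to infinity along which `|y1| ≤ 2B`; this kills the boundary term, and integrability of `φ`
  -- makes one sequence enough.
  have hslope : ∀ n : ℕ, ∃ t : ℝ, (n : ℝ) ≤ t ∧ |y1 (x - t)| ≤ 2 * B := by
    intro n
    obtain ⟨z, hz, hz'⟩ := exists_hasDerivAt_eq_slope y y1
      (show x - (n + 1 : ℝ) < x - n by linarith) hy.continuousOn (fun z _ => h1 z)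
    refine ⟨x - z, by linarith [hz.2], ?_⟩
    rw [sub_sub_cancel, hz', show x - (n : ℝ) - (x - (n + 1)) = 1 by ring, div_one]
    exact (abs_sub _ _).trans (by linarith [hB (x - n), hB (x - (n + 1))])
  choose t ht1 ht2 using hslope
  have htt : Tendsto t atTop atTop := tendsto_atTop_mono ht1 tendsto_natCast_atTop_atTop
  have hlim1 : Tendsto (fun n => F (t n) - F 0) atTop (𝓝 (∫ t in Set.Ioi (0 : ℝ), φ t)) := by
    simp only [← hFTC]
    exact intervalIntegral_tendsto_integral_Ioi 0 hint htt
  have hlim2 : Tendsto (fun n => F (t n)) atTop (𝓝 0) := by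
    have hb : ∀ n, ‖F (t n)‖ ≤ Real.exp (α * t n) * (|α * d - c| * B + |d| * (2 * B)) := by
      intro n
      rw [hF, norm_mul, Real.norm_of_nonneg (Real.exp_pos _).le]
      refine mul_le_mul_of_nonneg_left ((norm_add_le _ _).trans ?_) (Real.exp_pos _).le
      rw [norm_mul, norm_mul]
      exact add_le_add (mul_le_mul_of_nonneg_left (hB _) (abs_nonneg _))
        (mul_le_mul_of_nonneg_left (ht2 n) (abs_nonneg _))
    refine squeeze_zero_norm hb ?_
    have h3 : Tendsto (fun n => Real.exp (α * t n)) atTop (𝓝 0) :=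
      Real.tendsto_exp_atBot.comp (htt.const_mul_atTop_of_neg hα)
    simpa using h3.mul_const (|α * d - c| * B + |d| * (2 * B))
  have h4 := tendsto_nhds_unique hlim1 (hlim2.sub_const (F 0))
  rw [h4]
  simp only [hF, mul_zero, Real.exp_zero, sub_zero]
  ring

theorem hasDerivAt_comp_neg' {y : ℝ → ℝ} {y' z : ℝ} (h : HasDerivAt y y' (-z)) :
    HasDerivAt (fun z => y (-z)) (-y') z :=
  (h.comp z (hasDerivAt_neg z)).congr_deriv (mul_neg_one y')

/-- Reflection `x ↦ -x` changes the sign of `c` and turns the root `β` into `-β`. -/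
theorem integral_exp_mul_operator' {d c a β B B' : ℝ} {y y1 y2 : ℝ → ℝ} (hβ : 0 < β)
    (hroot : d * β ^ 2 - c * β + a = 0) (h1 : ∀ x, HasDerivAt y (y1 x) x)
    (h2 : ∀ x, HasDerivAt y1 (y2 x) x) (hy2 : Continuous y2) (hB : ∀ x, |y x| ≤ B)
    (hB' : ∀ x, |c * y1 x - d * y2 x - a * y x| ≤ B') (x : ℝ) :
    ∫ t in Set.Iic (0 : ℝ), Real.exp (β * t) *
      (c * y1 (x - t) - d * y2 (x - t) - a * y (x - t)) = (β * d - c) * y x + d * y1 x := by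
  have h := integral_exp_mul_operator (d := d) (c := -c) (a := a) (α := -β) (B := B) (B' := B')
    (y := fun z => y (-z)) (y1 := fun z => -y1 (-z)) (y2 := fun z => y2 (-z)) (by linarith)
    (by linarith) (fun z => hasDerivAt_comp_neg' (h1 (-z)))
    (fun z => (hasDerivAt_comp_neg' (h2 (-z))).neg.congr_deriv (neg_neg _))
    (hy2.comp continuous_neg) (fun z => hB _) (fun z => by simpa using hB' (-z)) (-x)
  have e := integral_comp_neg_Ioi (0 : ℝ) fun t => Real.exp (β * t) *
      (c * y1 (x - t) - d * y2 (x - t) - a * y (x - t))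
  rw [neg_zero] at e
  rw [← e]
  simp only [neg_sub, neg_neg, neg_mul_neg] at h
  calc _ = ∫ t in Set.Ioi (0 : ℝ), Real.exp (-β * t) *
      (c * y1 (- (-x - t)) - d * y2 (- (-x - t)) - a * y (- (-x - t))) := by
        congr 1
        ext t
        rw [show -(-x - t) = x - -t by ring, neg_mul, mul_neg]
    _ = _ := by
        simp only [neg_sub, sub_neg_eq_add] at h ⊢
        rw [h]
        ring

/-- Parameters of the Green kernel of `c ∂ - d ∂² - a`. -/
structure IsGreen (d c a p p' α β : ℝ) : Prop where
  p_nonneg : 0 ≤ p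
  p'_nonneg : 0 ≤ p'
  p_add_pos : 0 < p + p'
  α_neg : α < 0
  β_pos : 0 < β
  -- The alternatives allow `d = 0`: the operator is then of first order, has a single root, and its
  -- kernel lives on one side.
  root_α : p = 0 ∨ d * α ^ 2 - c * α + a = 0
  root_β : p' = 0 ∨ d * β ^ 2 - c * β + a = 0
  jump : p * (c - α * d) + p' * (β * d - c) = 1
  balance : p * d = p' * d
  moment : ∀ x, α < x → x < β → p / (x - α) + p' / (β - x) = 1 / (-(d * x ^ 2 - c * x + a))

/-- For `d > 0` the kernel uses the two roots of the quadratic, with weight the inverse square root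
of the discriminant on both sides; negativity at `μ` places `μ` between the roots. For `d = 0` the
sign of `c` decides which side survives. -/
theorem exists_isGreen {d c a μ : ℝ} (hd : 0 ≤ d) (hdc : 0 < d ∨ c ≠ 0) (ha : a < 0) (hμ : 0 < μ)
    (hsym : d * μ ^ 2 - c * μ + a < 0) : ∃ p p' α β, IsGreen d c a p p' α β ∧ μ < β := by
  rcases hd.eq_or_lt with rfl | hd
  · have hc : c ≠ 0 := hdc.resolve_left (lt_irrefl _)
    rcases lt_or_gt_of_ne hc with hc | hc
    · refine ⟨0, -1 / c, -1, a / c, ⟨le_rfl, ?_, ?_, by norm_num, ?_, Or.inl rfl, Or.inr ?_, ?_,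
        by ring, fun x _ hx => ?_⟩, ?_⟩
      · exact div_nonneg_of_nonpos (by norm_num) hc.le
      · rw [zero_add]; exact div_pos_of_neg_of_neg (by norm_num) hc
      · exact div_pos_of_neg_of_neg ha hc
      · field_simp; ring
      · field_simp; ring
      · have h1 : a / c - x ≠ 0 := by linarith
        have h2 : -(0 * x ^ 2 - c * x + a) = -c * (a / c - x) := by field_simp; ring
        rw [h2]
        field_simp
        ring
      · rw [lt_div_iff_of_neg hc]; linarith
    · have hac : a / c < 0 := div_neg_of_neg_of_pos ha hc
      refine ⟨1 / c, 0, a / c, μ + 1, ⟨by positivity, le_rfl, by positivity, hac, by positivity,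
        Or.inr ?_, Or.inl rfl, ?_, by ring, fun x hx _ => ?_⟩, by linarith⟩
      · field_simp; ring
      · field_simp; ring
      · have h1 : x - a / c ≠ 0 := by linarith
        have h2 : -(0 * x ^ 2 - c * x + a) = c * (x - a / c) := by field_simp; ring
        rw [h2]
        field_simp
        ring
  · set D := Real.sqrt (c ^ 2 - 4 * d * a) with hD
    have hD2 : D ^ 2 = c ^ 2 - 4 * d * a := Real.sq_sqrt (by nlinarith [sq_nonneg c])
    have hDc : |c| < D := by
      rw [← Real.sqrt_sq_eq_abs]
      exact Real.sqrt_lt_sqrt (sq_nonneg c) (by nlinarith)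
    obtain ⟨hc1, hc2⟩ := abs_lt.1 hDc
    have hfac : ∀ x, d * x ^ 2 - c * x + a = d * (x - (c - D) / (2 * d)) * (x - (c + D) / (2 * d)) := by
      intro x
      field_simp
      linear_combination (1 : ℝ) * hD2
    set α := (c - D) / (2 * d) with hα
    set β := (c + D) / (2 * d) with hβ
    have hα0 : α < 0 := div_neg_of_neg_of_pos (by linarith) (by linarith)
    have hβ0 : 0 < β := div_pos (by linarith) (by linarith)
    have hβα : β - α = D / d := by rw [hα, hβ]; field_simp; ring
    have hD0 : 0 < D := by linarith
    have hsum : d * (β + α) = c := by rw [hα, hβ]; field_simp; ring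
    refine ⟨1 / D, 1 / D, α, β, ⟨by positivity, by positivity, by positivity, hα0, hβ0,
      Or.inr (by rw [hfac]; ring), Or.inr (by rw [hfac]; ring), ?_, rfl, fun x h1 h2 => ?_⟩, ?_⟩
    · have : d * (β - α) = D := by rw [hβα]; field_simp
      field_simp
      linarith
    · have e1 : x - α ≠ 0 := by linarith
      have e2 : β - x ≠ 0 := by linarith
      have e3 : D = d * (β - α) := by rw [hβα]; field_simp
      have e4 : β - α ≠ 0 := by linarith
      rw [hfac, e3, show -(d * (x - α) * (x - β)) = d * (x - α) * (β - x) by ring]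
      field_simp
      ring
    · by_contra! h
      rw [hfac] at hsym
      have : 0 ≤ d * (μ - α) * (μ - β) :=
        mul_nonneg (mul_nonneg hd.le (by linarith)) (by linarith)
      linarith

/-- Representation of bounded functions by the Green kernel. -/
theorem IsGreen.integral_mul_operator {d c a p p' α β B B' : ℝ} (h : IsGreen d c a p p' α β)
    {y y1 y2 : ℝ → ℝ} (h1 : ∀ x, HasDerivAt y (y1 x) x)
    (h2 : ∀ x, HasDerivAt y1 (y2 x) x) (hy2 : Continuous y2) (hB : ∀ x, |y x| ≤ B)
    (hB' : ∀ x, |c * y1 x - d * y2 x - a * y x| ≤ B') (x : ℝ) :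
    ∫ t, green p p' α β t * (c * y1 (x - t) - d * y2 (x - t) - a * y (x - t)) = y x := by
  have hy : Continuous y := continuous_iff_continuousAt.2 fun z => (h1 z).continuousAt
  have hy1 : Continuous y1 := continuous_iff_continuousAt.2 fun z => (h2 z).continuousAt
  have hc : Continuous fun t => c * y1 (x - t) - d * y2 (x - t) - a * y (x - t) := by fun_prop
  rw [integral_green_mul ((integrable_green h.α_neg h.β_pos).mul_bdd (c := B')
    hc.aestronglyMeasurable (ae_of_all _ fun t => hB' _))]
  have e1 : p * (∫ t in Set.Ioi (0 : ℝ), Real.exp (α * t) *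
      (c * y1 (x - t) - d * y2 (x - t) - a * y (x - t))) =
      p * ((c - α * d) * y x - d * y1 x) := by
    rcases h.root_α with hp | hr
    · rw [hp, zero_mul, zero_mul]
    · rw [integral_exp_mul_operator h.α_neg hr h1 h2 hy2 hB hB']
  have e2 : p' * (∫ t in Set.Iic (0 : ℝ), Real.exp (β * t) *
      (c * y1 (x - t) - d * y2 (x - t) - a * y (x - t))) =
      p' * ((β * d - c) * y x + d * y1 x) := by
    rcases h.root_β with hp | hr
    · rw [hp, zero_mul, zero_mul]
    · rw [integral_exp_mul_operator' h.β_pos hr h1 h2 hy2 hB hB']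
  rw [e1, e2]
  linear_combination y x * h.jump - y1 x * h.balance

end

end NonlocalWave

/-! ### The renewal kernel. -/

namespace NonlocalWave

noncomputable section

/-- The Green kernel convolved with the exponentially tilted dispersal kernel. -/
def renewalKernel (b p p' α β μ : ℝ) (J : ℝ → ℝ) (s : ℝ) : ℝ :=
  b * ∫ t, green p p' α β t * (J (s - t) * Real.exp (μ * (s - t)))

section

variable {d c a b p p' α β μ : ℝ} {J : ℝ → ℝ}

theorem continuous_tilt (hJ : IsKernel J) : Continuous fun s => J s * Real.exp (μ * s) :=
  hJ.continuous.mul (by fun_prop)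

theorem IsGreen.integrable_green_tilt (h : IsGreen d c a p p' α β) (hJ : IsKernel J) (s : ℝ) :
    Integrable fun t => green p p' α β t * (J (s - t) * Real.exp (μ * (s - t))) := by
  refine ((hJ.exp_moment μ).comp_sub_left s).bdd_mul (c := p + p')
    measurable_green.aestronglyMeasurable (ae_of_all _ fun t => ?_)
  rw [Real.norm_of_nonneg (green_nonneg h.p_nonneg h.p'_nonneg t)]
  exact green_le h.p_nonneg h.p'_nonneg h.α_neg h.β_pos t

theorem IsGreen.renewalKernel_nonneg (h : IsGreen d c a p p' α β) (hJ : IsKernel J) (hb : 0 ≤ b)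
    (s : ℝ) : 0 ≤ renewalKernel b p p' α β μ J s :=
  mul_nonneg hb (integral_nonneg fun t => mul_nonneg (green_nonneg h.p_nonneg h.p'_nonneg t)
    (mul_nonneg (hJ.nonneg _) (Real.exp_pos _).le))

/-- An exponential is a character, so tilting a convolution tilts each factor. Laplace transforms of
the renewal kernel therefore factor. -/
theorem renewalKernel_mul_exp (x s : ℝ) :
    renewalKernel b p p' α β μ J s * Real.exp (-x * s) =
      b * convolution (fun t => green p p' α β t * Real.exp (-x * t))
        (fun t => J t * Real.exp ((μ - x) * t)) (ContinuousLinearMap.mul ℝ ℝ) volume s := by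
  rw [renewalKernel, mul_assoc, ← integral_mul_const]
  simp only [convolution, ContinuousLinearMap.mul_apply']
  congr 2
  ext t
  have : Real.exp (μ * (s - t)) * Real.exp (-x * s) =
      Real.exp (-x * t) * Real.exp ((μ - x) * (s - t)) := by
    rw [← Real.exp_add, ← Real.exp_add]
    ring_nf
  linear_combination green p p' α β t * J (s - t) * this

theorem integrable_renewalKernel_mul_exp (hJ : IsKernel J) {x : ℝ} (hα : α < x) (hβ : x < β) :
    Integrable fun s => renewalKernel b p p' α β μ J s * Real.exp (-x * s) := by
  simp only [renewalKernel_mul_exp]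
  exact ((integrable_green_mul_exp hα hβ).integrable_convolution _
    (hJ.exp_moment (μ - x))).const_mul b

theorem integral_renewalKernel_mul_exp (hJ : IsKernel J) {x : ℝ} (hα : α < x) (hβ : x < β) :
    ∫ s, renewalKernel b p p' α β μ J s * Real.exp (-x * s) =
      b * ((p / (x - α) + p' / (β - x)) * expMoment J (μ - x)) := by
  simp only [renewalKernel_mul_exp]
  rw [integral_const_mul, integral_convolution _ (integrable_green_mul_exp hα hβ)
    (hJ.exp_moment (μ - x)), integral_green_mul_exp hα hβ]
  rfl

theorem IsGreen.integrable_renewalKernel (h : IsGreen d c a p p' α β) (hJ : IsKernel J) :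
    Integrable (renewalKernel b p p' α β μ J) := by
  simpa using integrable_renewalKernel_mul_exp (b := b) (p := p) (p' := p') (μ := μ) hJ
    h.α_neg h.β_pos

/-- The kernel has exponential moments of both signs at a small rate `e`, and these dominate `|s|`.
-/
theorem IsGreen.integrable_id_mul_renewalKernel (h : IsGreen d c a p p' α β) (hJ : IsKernel J)
    (hb : 0 ≤ b) : Integrable fun s => s * renewalKernel b p p' α β μ J s := by
  have hα := h.α_neg
  have hβ := h.β_pos
  set e := min (-α) β / 2 with he
  have he0 : 0 < e := half_pos (lt_min (by linarith) hβ)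
  have he1 : e < -α := lt_of_lt_of_le (half_lt_self (lt_min (by linarith) hβ)) (min_le_left _ _)
  have he2 : e < β := lt_of_lt_of_le (half_lt_self (lt_min (by linarith) hβ)) (min_le_right _ _)
  have i1 := integrable_renewalKernel_mul_exp (b := b) (p := p) (p' := p') (μ := μ) hJ
    (show α < e by linarith) he2
  have i2 := integrable_renewalKernel_mul_exp (b := b) (p := p) (p' := p') (μ := μ) hJ
    (show α < -e by linarith) (show -e < β by linarith)
  refine Integrable.mono' ((i1.add i2).const_mul e⁻¹)
    (aestronglyMeasurable_id.mul (h.integrable_renewalKernel hJ).aestronglyMeasurable)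
    (ae_of_all _ fun s => ?_)
  have hk := h.renewalKernel_nonneg (μ := μ) hJ hb s
  set k := renewalKernel b p p' α β μ J s
  rw [norm_mul, Real.norm_of_nonneg hk]
  simp only [Pi.add_apply, neg_neg]
  have h1 : |s| ≤ e⁻¹ * (Real.exp (-e * s) + Real.exp (e * s)) := by
    rw [inv_mul_eq_div, le_div_iff₀ he0]
    have t1 := Real.add_one_le_exp (-e * s)
    have t2 := Real.add_one_le_exp (e * s)
    have t3 := Real.exp_pos (-e * s)
    have t4 := Real.exp_pos (e * s)
    rcases abs_cases s with ⟨hs, _⟩ | ⟨hs, _⟩ <;> rw [hs] <;> linarith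
  have h2 := mul_le_mul_of_nonneg_right h1 hk
  rw [Real.norm_eq_abs]
  linarith

/-- One point of positivity is enough for a continuous integrand; `t ≠ 0` avoids the possible jump
of the Green kernel. -/
theorem IsGreen.renewalKernel_pos (h : IsGreen d c a p p' α β) (hJ : IsKernel J) (hb : 0 < b)
    {s t : ℝ} (ht : t ≠ 0) (hg : 0 < green p p' α β t) (hJs : 0 < J (s - t)) :
    0 < renewalKernel b p p' α β μ J s := by
  refine mul_pos hb (integral_pos_of_continuousAt (fun t => mul_nonneg
    (green_nonneg h.p_nonneg h.p'_nonneg t) (mul_nonneg (hJ.nonneg _) (Real.exp_pos _).le))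
    (h.integrable_green_tilt hJ s) (x := t) ?_ (mul_pos hg (mul_pos hJs (Real.exp_pos _))))
  exact (continuousAt_green ht).mul
    ((continuous_tilt hJ).comp (continuous_const.sub continuous_id)).continuousAt

/-- The set where the renewal kernel is positive is an interval around the origin. -/
theorem IsGreen.renewalKernel_connected (h : IsGreen d c a p p' α β) (hJ : IsKernel J)
    (hb : 0 < b) (s : ℝ) (hs : renewalKernel b p p' α β μ J s ≠ 0) (r : ℝ)
    (hr : r ∈ Set.uIcc 0 s) : renewalKernel b p p' α β μ J r ≠ 0 := by
  obtain ⟨y, hy, hJy⟩ := hJ.exists_neg_pos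
  have hJy' : 0 < J (-y) := by rwa [hJ.even]
  have hgp : 0 < p → ∀ t > 0, 0 < green p p' α β t := fun hp t ht => by
    rw [green_of_pos ht]; positivity
  have hgn : 0 < p' → ∀ t < 0, 0 < green p p' α β t := fun hp t ht => by
    rw [green_of_nonpos ht.le]; positivity
  -- A right-sided Green kernel spreads positivity of `J` to every point further right, a left-sided
  -- one to every point further left. As `J` is positive somewhere on each side of `0`, this covers
  -- the segment from `0` to `s`.
  have hP : 0 < p → ∀ r z, z < r → 0 < J z → renewalKernel b p p' α β μ J r ≠ 0 :=
    fun hp r z hz hJz => (h.renewalKernel_pos hJ hb (t := r - z) (by linarith)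
      (hgp hp _ (by linarith)) (by rwa [sub_sub_cancel])).ne'
  have hN : 0 < p' → ∀ r z, r < z → 0 < J z → renewalKernel b p p' α β μ J r ≠ 0 :=
    fun hp r z hz hJz => (h.renewalKernel_pos hJ hb (t := r - z) (by linarith)
      (hgn hp _ (by linarith)) (by rwa [sub_sub_cancel])).ne'
  obtain ⟨t, ht⟩ : ∃ t, green p p' α β t * (J (s - t) * Real.exp (μ * (s - t))) ≠ 0 := by
    by_contra! h0
    exact hs (by simp [renewalKernel, h0])
  have hJst : 0 < J (s - t) :=
    lt_of_le_of_ne (hJ.nonneg _) fun h0 => ht (by rw [← h0]; ring)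
  have hopen : ∀ᶠ z in 𝓝 (s - t), 0 < J z :=
    hJ.continuous.continuousAt.eventually (lt_mem_nhds hJst)
  rcases h.p_nonneg.eq_or_lt with hp | hp
  · have hp' : 0 < p' := by linarith [h.p_add_pos]
    have ht0 : t ≤ 0 := by
      by_contra! h0
      exact ht (by rw [green_of_pos h0, ← hp]; ring)
    -- Here `t = 0` is possible, so `s - t` need not lie strictly to the right of `r`; continuity of
    -- `J` leaves room to move right.
    have hright : ∀ᶠ z in 𝓝[>] (s - t), 0 < J z := hopen.filter_mono nhdsWithin_le_nhds
    obtain ⟨z, hz, hJz⟩ := (hright.and self_mem_nhdsWithin).exists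
    rcases Set.mem_uIcc.1 hr with ⟨hr1, hr2⟩ | ⟨hr1, hr2⟩
    · exact hN hp' r z (by linarith [show s - t < z from hJz]) hz
    · exact hN hp' r (-y) (by linarith) hJy'
  · rcases h.p'_nonneg.eq_or_lt with hp' | hp'
    · have ht0 : 0 < t := by
        by_contra! h0
        exact ht (by rw [green_of_nonpos h0, ← hp']; ring)
      rcases Set.mem_uIcc.1 hr with ⟨hr1, hr2⟩ | ⟨hr1, hr2⟩
      · exact hP hp r y (by linarith) hJy
      · exact hP hp r (s - t) (by linarith) hJst
    · rcases le_or_gt r y with h1 | h1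
      · exact hN hp' r (-y) (by linarith) hJy'
      · exact hP hp r y h1 hJy

/-- Associativity of the convolutions with the Green and the dispersal kernel. -/
theorem IsGreen.integral_renewalKernel_mul (h : IsGreen d c a p p' α β) (hJ : IsKernel J)
    {v : ℝ → ℝ} (hv : Continuous v) {B : ℝ} (hB : ∀ x, |v x| ≤ B) (x : ℝ) :
    ∫ s, renewalKernel b p p' α β μ J s * v (x - s) =
      ∫ t, green p p' α β t *
        (b * ∫ s, J s * Real.exp (μ * s) * v (x - t - s)) := by
  have hG := integrable_green (p := p) (p' := p') h.α_neg h.β_pos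
  have hT := hJ.exp_moment μ
  have habs : ∀ z, Integrable fun s => ‖J s * Real.exp (μ * s)‖ * ‖v (z - s)‖ := fun z =>
    hT.norm.mul_bdd (c := B)
      (hv.norm.comp (continuous_const.sub continuous_id)).aestronglyMeasurable
      (ae_of_all _ fun s => by simpa using hB _)
  have hassoc := convolution_assoc (μ := (volume : Measure ℝ)) (ν := (volume : Measure ℝ))
    (ContinuousLinearMap.mul ℝ ℝ) (ContinuousLinearMap.mul ℝ ℝ)
    (ContinuousLinearMap.mul ℝ ℝ) (ContinuousLinearMap.mul ℝ ℝ)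
    (f := green p p' α β) (g := fun s => J s * Real.exp (μ * s)) (k := v)
    (fun x y z => by simp [mul_assoc]) (x₀ := x) hG.aestronglyMeasurable hT.aestronglyMeasurable
    hv.aestronglyMeasurable (ae_of_all _ fun y => h.integrable_green_tilt hJ y)
    (ae_of_all _ habs) ?_
  · simp only [convolution, ContinuousLinearMap.mul_apply'] at hassoc
    simp only [renewalKernel, mul_assoc]
    rw [integral_const_mul]
    simp only [mul_assoc] at hassoc
    rw [hassoc, ← integral_const_mul]
    congr 1
    ext t
    ring
  · have hbd : ∀ z, ‖∫ s, ‖J s * Real.exp (μ * s)‖ * ‖v (z - s)‖‖ ≤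
        (∫ s, ‖J s * Real.exp (μ * s)‖) * B := by
      intro z
      rw [Real.norm_of_nonneg (integral_nonneg fun s => by positivity), ← integral_mul_const]
      exact integral_mono (habs z) (hT.norm.mul_const B) fun s =>
        mul_le_mul_of_nonneg_left (hB _) (norm_nonneg _)
    refine hG.norm.mul_bdd (c := (∫ s, ‖J s * Real.exp (μ * s)‖) * B) ?_
      (ae_of_all _ fun t => hbd _)
    have hc : Continuous fun z => ∫ s, ‖J s * Real.exp (μ * s)‖ * ‖v (z - s)‖ := by
      refine continuous_of_dominated (bound := fun s => ‖J s * Real.exp (μ * s)‖ * B)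
        (fun z => (habs z).aestronglyMeasurable) (fun z => ae_of_all _ fun s => ?_)
        (hT.norm.mul_const B) (ae_of_all _ fun s => by fun_prop)
      rw [norm_mul, norm_norm, norm_norm]
      exact mul_le_mul_of_nonneg_left (hB _) (norm_nonneg _)
    exact (hc.comp (continuous_const.sub continuous_id)).aestronglyMeasurable

end

end

end NonlocalWave

/-! ### Convergence of the exponentially tilted tail. -/

namespace NonlocalWave

noncomputable section

variable {d c a b C μ : ℝ} {J w w1 w2 R : ℝ → ℝ}

theorem tendsto_integral_green_mul {p p' α β B : ℝ} (hα : α < 0) (hβ : 0 < β) {g : ℝ → ℝ}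
    (hg : Continuous g) (hB : ∀ x, |g x| ≤ B) (hg0 : Tendsto g atTop (𝓝 0)) :
    Tendsto (fun x => ∫ t, green p p' α β t * g (x - t)) atTop (𝓝 0) := by
  have hG := integrable_green (p := p) (p' := p') hα hβ
  suffices h0 : Tendsto (fun x => ∫ t, green p p' α β t * g (x - t)) atTop
      (𝓝 (∫ t, green p p' α β t * 0)) by simpa only [mul_zero, integral_zero] using h0
  refine tendsto_integral_filter_of_dominated_convergence (fun t => ‖green p p' α β t‖ * B)
    (Eventually.of_forall fun x => hG.aestronglyMeasurable.mul
      (hg.comp (continuous_const.sub continuous_id)).aestronglyMeasurable)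
    (Eventually.of_forall fun x => ae_of_all _ fun t => ?_) (hG.norm.mul_const _)
    (ae_of_all _ fun t => ?_)
  · rw [norm_mul]
    exact mul_le_mul_of_nonneg_left (hB _) (norm_nonneg _)
  · exact (hg0.comp (tendsto_atTop_add_const_right atTop (-t) tendsto_id)).const_mul _

namespace IsTail

theorem continuous_deriv (h : IsTail d c a b C J w w1 w2 R) : Continuous w1 :=
  continuous_iff_continuousAt.2 fun z => (h.hasDeriv' z).continuousAt

theorem continuous_remainder (h : IsTail d c a b C J w w1 w2 R) : Continuous R := by
  have hc : Continuous fun x => ∫ s, J s * w (x - s) := by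
    refine continuous_of_dominated (bound := fun s => J s * 2)
      (fun x => (h.integrable x).aestronglyMeasurable) (fun x => ae_of_all _ fun s => ?_)
      (h.kernel.integrable.mul_const 2)
      (ae_of_all _ fun s =>
        continuous_const.mul (h.continuous.comp (continuous_id.sub continuous_const)))
    rw [norm_mul, Real.norm_of_nonneg (h.kernel.nonneg s)]
    exact mul_le_mul_of_nonneg_left (h.abs_le_two _) (h.kernel.nonneg s)
  rw [← funext h.equation]
  have h0 := h.continuous
  have h1 := h.continuous_deriv
  have h2 := h.continuous'
  fun_prop

theorem abs_remainder_le (h : IsTail d c a b C J w w1 w2 R) (x : ℝ) : |R x| ≤ C * 8 := by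
  refine (h.quadratic x).trans (mul_le_mul_of_nonneg_left ?_ h.C_nonneg)
  have hj : ∫ s, J s * w (x - s) ≤ 2 := by
    have h1 : ∫ s, J s * w (x - s) ≤ ∫ s, J s * 2 :=
      integral_mono (h.integrable x) (h.kernel.integrable.mul_const 2) fun s =>
        mul_le_mul_of_nonneg_left (h.le_two _) (h.kernel.nonneg s)
    rwa [integral_mul_const, h.kernel.mass_one, one_mul] at h1
  nlinarith [h.pos x, h.le_two x, h.avg_nonneg x]

/-- The tilted remainder is bounded, integrable, and vanishes at `+∞`. -/
theorem tilted_remainder (h : IsTail d c a b C J w w1 w2 R) (hμ : 0 < μ)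
    (hμ0 : symb d c a b J (-μ) = 0) :
    ∃ B, (∀ x, |R x * Real.exp (μ * x)| ≤ B) ∧ Integrable (fun x => R x * Real.exp (μ * x)) ∧
      Tendsto (fun x => R x * Real.exp (μ * x)) atTop (𝓝 0) := by
  obtain ⟨C', hC', hR⟩ := h.exists_remainder_le_exp hμ hμ0
  have hC := h.C_nonneg
  have hc : Continuous fun x => R x * Real.exp (μ * x) :=
    h.continuous_remainder.mul (by fun_prop)
  have h1 : ∀ x, |R x * Real.exp (μ * x)| ≤ C' * Real.exp (-(μ / 2) * x) := by
    intro x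
    rw [abs_mul, abs_of_pos (Real.exp_pos _)]
    refine (mul_le_mul_of_nonneg_right (hR x) (Real.exp_pos _).le).trans_eq ?_
    rw [mul_assoc, ← Real.exp_add]
    ring_nf
  have h2 : ∀ x, |R x * Real.exp (μ * x)| ≤ C * 8 * Real.exp (μ * x) := by
    intro x
    rw [abs_mul, abs_of_pos (Real.exp_pos _)]
    exact mul_le_mul_of_nonneg_right (h.abs_remainder_le x) (Real.exp_pos _).le
  refine ⟨C' + C * 8, fun x => ?_, integrable_of_Iic_of_Ioi ?_ ?_, ?_⟩
  · rcases le_total 0 x with hx | hx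
    · have : Real.exp (-(μ / 2) * x) ≤ 1 := Real.exp_le_one_iff.2 (by nlinarith)
      exact (h1 x).trans (by nlinarith)
    · have : Real.exp (μ * x) ≤ 1 := Real.exp_le_one_iff.2 (by nlinarith)
      exact (h2 x).trans (by nlinarith)
  · exact Integrable.mono' ((integrableOn_exp_mul_Iic hμ 0).const_mul (C * 8))
      hc.aestronglyMeasurable (ae_of_all _ h2)
  · exact Integrable.mono'
      ((integrableOn_exp_mul_Ioi (show -(μ / 2) < 0 by linarith) 0).const_mul C')
      hc.aestronglyMeasurable (ae_of_all _ h1)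
  · refine squeeze_zero_norm h1 ?_
    simpa using (tendsto_exp_neg_mul (half_pos hμ)).const_mul C'

/-- The tilted tail converges. -/
theorem exists_tendsto_tilt (h : IsTail d c a b C J w w1 w2 R) (hμ : 0 < μ)
    (hμ0 : symb d c a b J (-μ) = 0) (hdc : 0 < d ∨ c ≠ 0) :
    ∃ D, Tendsto (fun x => w x * Real.exp (μ * x)) atTop (𝓝 D) := by
  have hJ := h.kernel
  have hb := h.b_pos
  have ha : a < 0 := by linarith [h.ab_neg]
  obtain ⟨M, hM, hw⟩ := h.exists_le_exp_root hμ hμ0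
  obtain ⟨B, hgB, hgi, hg0⟩ := h.tilted_remainder hμ hμ0
  set g := fun x => R x * Real.exp (μ * x) with hg
  have hgc : Continuous g := h.continuous_remainder.mul (by fun_prop)
  set E := expMoment J μ with hE
  have hE0 : 0 < E := by
    have := expMoment_growth hJ μ
    have h1 := hJ.integral_sq_pos
    have h2 : 0 ≤ (∫ s, J s * s ^ 2) / 4 * μ ^ 2 := by positivity
    linarith
  have hroot : d * μ ^ 2 + c * μ + a + b * E = 0 := by
    rw [symb, neg_neg] at hμ0
    linarith
  -- Coefficients of the local operator conjugated by `e^{μx}`; `hroot` rewrites the zeroth-order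
  -- one as `-(b * E)`.
  set c' := c + 2 * d * μ with hc'
  set a' := -(b * E) with ha'
  have hbE : 0 < b * E := mul_pos hb hE0
  have hsym : d * μ ^ 2 - c' * μ + a' = a := by rw [hc', ha']; linarith
  obtain ⟨p, p', α, β, hG, hμβ⟩ := exists_isGreen (d := d) (c := c') (a := a') (μ := μ)
    h.d_nonneg (by
      rcases hdc with h1 | h1
      · exact Or.inl h1
      · rcases h.d_nonneg.eq_or_lt with h2 | h2
        · right
          rw [hc', ← h2]
          simpa using h1
        · exact Or.inl h2) (by linarith) hμ (by rw [hsym]; exact ha)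
  set v := fun x => w x * Real.exp (μ * x) with hv
  set v1 := fun x => (w1 x + μ * w x) * Real.exp (μ * x) with hv1
  set v2 := fun x => (w2 x + 2 * μ * w1 x + μ ^ 2 * w x) * Real.exp (μ * x) with hv2
  have hexp : ∀ x, HasDerivAt (fun x => Real.exp (μ * x)) (μ * Real.exp (μ * x)) x := by
    intro x
    have := hasDerivAt_exp_neg_mul (-μ) x
    simpa only [neg_neg] using this
  have hd1 : ∀ x, HasDerivAt v (v1 x) x := fun x =>
    ((h.hasDeriv x).mul (hexp x)).congr_deriv (by rw [hv1]; ring)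
  have hd2 : ∀ x, HasDerivAt v1 (v2 x) x := fun x =>
    (((h.hasDeriv' x).add ((h.hasDeriv x).const_mul μ)).mul (hexp x)).congr_deriv
      (by simp only [hv2, Pi.add_apply]; ring)
  have hw0 := h.continuous
  have hw1 := h.continuous_deriv
  have hw2 := h.continuous'
  have hv2c : Continuous v2 := by fun_prop
  have hvc : Continuous v := by fun_prop
  have hvB : ∀ x, |v x| ≤ M := by
    intro x
    rw [hv, abs_of_pos (mul_pos (h.pos x) (Real.exp_pos _))]
    refine (mul_le_mul_of_nonneg_right (hw x) (Real.exp_pos _).le).trans_eq ?_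
    rw [mul_assoc, ← Real.exp_add]
    simp
  have hop : ∀ x, c' * v1 x - d * v2 x - a' * v x =
      b * (∫ s, J s * Real.exp (μ * s) * v (x - s)) - g x := by
    intro x
    have e1 : ∫ s, J s * Real.exp (μ * s) * v (x - s) =
        (∫ s, J s * w (x - s)) * Real.exp (μ * x) := by
      rw [← integral_mul_const]
      congr 1
      ext s
      have : Real.exp (μ * x) = Real.exp (μ * s) * Real.exp (μ * (x - s)) := by
        rw [← Real.exp_add]
        ring_nf
      rw [hv, this]
      ring
    rw [e1]
    have heq := h.equation x
    simp only [hv, hv1, hv2, hg, hc', ha', ← heq]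
    linear_combination (w x * Real.exp (μ * x)) * hroot
  have hTB : ∀ x, |b * ∫ s, J s * Real.exp (μ * s) * v (x - s)| ≤ b * (E * M) := by
    intro x
    rw [abs_mul, abs_of_pos hb]
    refine mul_le_mul_of_nonneg_left ?_ hb.le
    rw [hE, expMoment, ← integral_mul_const, ← Real.norm_eq_abs]
    refine norm_integral_le_of_norm_le ((hJ.exp_moment μ).mul_const M) (ae_of_all _ fun s => ?_)
    rw [norm_mul, Real.norm_of_nonneg (mul_nonneg (hJ.nonneg s) (Real.exp_pos _).le)]
    exact mul_le_mul_of_nonneg_left (hvB _) (mul_nonneg (hJ.nonneg s) (Real.exp_pos _).le)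
  have hrep := hG.integral_mul_operator hd1 hd2 hv2c hvB (B' := b * (E * M) + B) fun x => by
    rw [hop]
    exact (abs_sub _ _).trans (add_le_add (hTB x) (hgB x))
  have hGi := integrable_green (p := p) (p' := p') hG.α_neg hG.β_pos
  -- Continuity of the nonlocal term is read off from the equation, all of whose other terms are
  -- continuous.
  have hTc : Continuous fun x => b * ∫ s, J s * Real.exp (μ * s) * v (x - s) := by
    have hv1c : Continuous v1 := by fun_prop
    have : (fun x => b * ∫ s, J s * Real.exp (μ * s) * v (x - s)) =
        fun x => c' * v1 x - d * v2 x - a' * v x + g x := by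
      ext x
      rw [hop]
      ring
    rw [this]
    fun_prop
  have hK := hG.integrable_renewalKernel (b := b) (μ := μ) hJ
  have hK0 := hG.renewalKernel_nonneg (μ := μ) hJ hb.le
  -- The Green kernel has mass `1 / (b E)`, the tilted `b J` has mass `b E`.
  have hK1 : ∫ s, renewalKernel b p p' α β μ J s = 1 := by
    have h1 := integral_renewalKernel_mul_exp (b := b) (p := p) (p' := p') (μ := μ) hJ
      hG.α_neg hG.β_pos
    rw [hG.moment 0 hG.α_neg hG.β_pos] at h1
    simp only [neg_zero, zero_mul, Real.exp_zero, mul_one, sub_zero] at h1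
    rw [h1, ← hE]
    simp only [ha']
    field_simp
    ring
  have hsK := hG.integrable_id_mul_renewalKernel (μ := μ) hJ hb.le
  have hα := hG.α_neg
  -- At `μ` the tilt is undone: the transform equals `b / (-a)`, which is below `1` because `a + b <
  -- 0`.
  have hKμ : ∫ s, renewalKernel b p p' α β μ J s * Real.exp (-μ * s) < 1 := by
    rw [integral_renewalKernel_mul_exp hJ (by linarith) hμβ, hG.moment μ (by linarith) hμβ, hsym,
      sub_self, expMoment_zero hJ, mul_one, mul_one_div, div_lt_one (by linarith)]
    linarith [h.ab_neg]
  -- With zero mean, `e^{-μs} ≥ 1 - μs` would make the transform at `μ` at least `1`.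
  have hm : ∫ s, s * renewalKernel b p p' α β μ J s ≠ 0 := by
    intro hm0
    have h1 : ∫ s, (renewalKernel b p p' α β μ J s - μ * (s * renewalKernel b p p' α β μ J s)) ≤
        ∫ s, renewalKernel b p p' α β μ J s * Real.exp (-μ * s) := by
      refine integral_mono (hK.sub (hsK.const_mul μ))
        (integrable_renewalKernel_mul_exp hJ (by linarith) hμβ) fun s => ?_
      have := mul_le_mul_of_nonneg_left (Real.add_one_le_exp (-μ * s)) (hK0 s)
      simp only
      linarith
    rw [integral_sub hK (hsK.const_mul μ), integral_const_mul, hm0, hK1] at h1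
    linarith
  have hrenew : ∀ x, v x - ∫ s, renewalKernel b p p' α β μ J s * v (x - s) =
      -∫ t, green p p' α β t * g (x - t) := by
    intro x
    have i1 : Integrable fun t => green p p' α β t *
        (b * ∫ s, J s * Real.exp (μ * s) * v (x - t - s)) :=
      hGi.mul_bdd (c := b * (E * M))
        (hTc.comp (continuous_const.sub continuous_id)).aestronglyMeasurable
        (ae_of_all _ fun t => hTB (x - t))
    have i2 : Integrable fun t => green p p' α β t * g (x - t) :=
      integrable_kernel_mul hGi hgc hgB x
    have h1 := hrep x
    simp only [hop, mul_sub] at h1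
    rw [integral_sub i1 i2] at h1
    rw [hG.integral_renewalKernel_mul hJ hvc hvB]
    linarith
  refine exists_tendsto_of_renewal hK0 hK hK1 hsK hm (hG.renewalKernel_connected hJ hb) hvc hvB
    hrenew ?_ ?_
  · exact (hGi.integrable_convolution (ContinuousLinearMap.mul ℝ ℝ) hgi).neg.integrableOn
  · simpa using (tendsto_integral_green_mul (p := p) (p' := p') hG.α_neg hG.β_pos hgc hgB
      hg0).neg

/-- Exact exponential asymptotics of the tail. -/
theorem exists_pos_tendsto_tilt (h : IsTail d c a b C J w w1 w2 R) (hμ : 0 < μ)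
    (hμ0 : symb d c a b J (-μ) = 0) (hdc : 0 < d ∨ c ≠ 0) :
    ∃ D, 0 < D ∧ Tendsto (fun x => w x * Real.exp (μ * x)) atTop (𝓝 D) := by
  obtain ⟨D, hD⟩ := h.exists_tendsto_tilt hμ hμ0 hdc
  obtain ⟨ε, hε, hw⟩ := h.exists_exp_root_le hμ hμ0
  refine ⟨D, lt_of_lt_of_le hε ?_, hD⟩
  -- The lower barrier multiplied by `e^{μx}` tends to `ε`, which bounds the limit away from zero.
  have h1 : Tendsto (fun x => ε * (1 - 2 * Real.exp (-(μ / 2) * x))) atTop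
      (𝓝 (ε * (1 - 2 * 0))) :=
    (((tendsto_exp_neg_mul (half_pos hμ)).const_mul 2).const_sub 1).const_mul ε
  rw [mul_zero, sub_zero, mul_one] at h1
  refine le_of_tendsto_of_tendsto' h1 hD fun x => ?_
  refine le_trans (le_of_eq ?_) (mul_le_mul_of_nonneg_right (hw x) (Real.exp_pos (μ * x)).le)
  have e1 : Real.exp (-μ * x) * Real.exp (μ * x) = 1 := by rw [← Real.exp_add]; simp
  have e2 : Real.exp (-(3 / 2 * μ) * x) * Real.exp (μ * x) = Real.exp (-(μ / 2) * x) := by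
    rw [← Real.exp_add]
    ring_nf
  linear_combination (-ε) * e1 + 2 * ε * e2

end IsTail

end

end NonlocalWave

/-! ### From traveling waves to tails, and reflection. -/

namespace NonlocalWave

noncomputable section

variable {d c : ℝ} {J U : ℝ → ℝ} {f : ℝ × ℝ → ℝ}

/-- A `C²` function agrees with its linearization on the square `[-1, 1]²` up to a quadratic
error. -/
theorem exists_taylor_bound (hf : ContDiff ℝ 2 f) {e : ℝ × ℝ}
    (he : e ∈ Set.Icc ((-1, -1) : ℝ × ℝ) (1, 1)) :
    ∃ C : ℝ, 0 ≤ C ∧ ∀ p ∈ Set.Icc ((-1, -1) : ℝ × ℝ) (1, 1),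
      |f p - f e - fderiv ℝ f e (p - e)| ≤ C * ‖p - e‖ ^ 2 := by
  have hconv : Convex ℝ (Set.Icc ((-1, -1) : ℝ × ℝ) (1, 1)) := convex_Icc _ _
  have h1 : ContDiff ℝ 1 (fderiv ℝ f) := hf.fderiv_right (by norm_num)
  -- The derivative is Lipschitz on the compact convex square, so the mean value inequality along
  -- the segment from `e` to `p` gives a quadratic error.
  obtain ⟨C, hC⟩ := h1.contDiffOn.exists_lipschitzOnWith one_ne_zero hconv isCompact_Icc
  refine ⟨C, C.2, fun p hp => ?_⟩
  have hseg := hconv.segment_subset he hp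
  have h2 := Convex.norm_image_sub_le_of_norm_fderiv_le' (𝕜 := ℝ) (f := f) (s := segment ℝ e p)
    (φ := fderiv ℝ f e) (C := C * ‖p - e‖) (fun x _ => hf.differentiable two_ne_zero x)
    (fun x hx => (hC.norm_sub_le (hseg hx) he).trans
      (mul_le_mul_of_nonneg_left (norm_sub_le_of_mem_segment hx) C.2))
    (convex_segment e p) (left_mem_segment ℝ e p) (right_mem_segment ℝ e p)
  rw [← Real.norm_eq_abs]
  exact h2.trans_eq (by ring)

theorem fderiv_apply_eq_partial (hf : Differentiable ℝ f) (r s h k : ℝ) :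
    fderiv ℝ f (r, s) (h, k) = partialR f r s * h + partialS f r s * k := by
  have hd := (hf (r, s)).hasFDerivAt
  have e1 : partialR f r s = fderiv ℝ f (r, s) (1, 0) :=
    (hd.comp_hasDerivAt r ((hasDerivAt_id r).prodMk (hasDerivAt_const r s))).deriv
  have e2 : partialS f r s = fderiv ℝ f (r, s) (0, 1) :=
    (hd.comp_hasDerivAt s ((hasDerivAt_const s r).prodMk (hasDerivAt_id s))).deriv
  rw [e1, e2, show ((h, k) : ℝ × ℝ) = h • (1, 0) + k • (0, 1) by simp, map_add, map_smul, map_smul,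
    smul_eq_mul, smul_eq_mul]
  ring

theorem conv_eq (J u : ℝ → ℝ) (x : ℝ) : conv J u x = ∫ s, J s * u (x - s) := by
  simp [conv, convolution]

namespace IsTravelingWave

theorem strictMono (h : IsTravelingWave d J f c U) : StrictMono U :=
  strictMono_of_deriv_pos h.deriv_pos

theorem lt_one (h : IsTravelingWave d J f c U) (x : ℝ) : U x < 1 :=
  (h.strictMono (lt_add_one x)).trans_le
    (h.strictMono.monotone.ge_of_tendsto h.tendsto_atTop (x + 1))

theorem neg_one_lt (h : IsTravelingWave d J f c U) (x : ℝ) : -1 < U x :=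
  (h.strictMono.monotone.le_of_tendsto h.tendsto_atBot (x - 1)).trans_lt
    (h.strictMono (sub_one_lt x))

/-- The deviation of a traveling wave from its limit at `+∞` is a tail. -/
theorem isTail (h : IsTravelingWave d J f c U) (hd : 0 ≤ d) (hJ : IsKernel J)
    (hf : ContDiff ℝ 2 f) (hf1 : f (1, 1) = 0) (hs : 0 < partialS f 1 1)
    (hst : partialR f 1 1 < -partialS f 1 1) :
    ∃ C R w1 w2, IsTail d c (partialR f 1 1) (partialS f 1 1) C J (fun x => 1 - U x) w1 w2 R := by
  obtain ⟨C, hC, hT⟩ := exists_taylor_bound hf (e := (1, 1)) ⟨by norm_num, le_rfl⟩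
  have hU0 : Continuous U := h.contDiff.continuous
  have hUabs : ∀ x, |U x| ≤ 1 := fun x => abs_le.2 ⟨(h.neg_one_lt x).le, (h.lt_one x).le⟩
  have hdU : ∀ x, HasDerivAt U (deriv U x) x := fun x =>
    (h.contDiff.differentiable two_ne_zero x).hasDerivAt
  have hc1 : ContDiff ℝ 1 (deriv U) := (contDiff_succ_iff_deriv.1 h.contDiff).2.2
  have hdU' : ∀ x, HasDerivAt (deriv U) (deriv (deriv U) x) x := fun x =>
    (hc1.differentiable one_ne_zero x).hasDerivAt
  have hint := fun x => hJ.integrable_mul_bounded hU0 hUabs x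
  have hj : ∀ x, ∫ s, J s * (1 - U (x - s)) = 1 - conv J U x := by
    intro x
    simp only [mul_sub, mul_one]
    rw [integral_sub hJ.integrable (hint x), hJ.mass_one, conv_eq]
  have hconv : ∀ x, |conv J U x| ≤ 1 := by
    intro x
    rw [conv_eq, ← hJ.mass_one, ← Real.norm_eq_abs]
    refine norm_integral_le_of_norm_le hJ.integrable (ae_of_all _ fun s => ?_)
    rw [norm_mul, Real.norm_of_nonneg (hJ.nonneg s)]
    exact mul_le_of_le_one_right (hJ.nonneg s) (hUabs _)
  -- The remainder is defined as the linear expression itself, so `equation` is trivial and the wave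
  -- equation enters only through `quadratic`.
  refine ⟨C, fun x => d * -deriv (deriv U) x - c * -deriv U x + partialR f 1 1 * (1 - U x) +
    partialS f 1 1 * ∫ s, J s * (1 - U (x - s)), fun x => -deriv U x,
    fun x => -deriv (deriv U) x,
    { kernel := hJ
      d_nonneg := hd
      b_pos := hs
      ab_neg := by linarith
      hasDeriv := fun x => (hdU x).const_sub 1
      hasDeriv' := fun x => (hdU' x).neg
      continuous' := (hc1.continuous_deriv le_rfl).neg
      equation := fun x => rfl
      pos := fun x => by linarith [h.lt_one x]
      le_two := fun x => by linarith [h.neg_one_lt x]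
      lim := by simpa using h.tendsto_atTop.const_sub 1
      C_nonneg := hC
      quadratic := fun x => ?_ }⟩
  rw [hj]
  have hp : (U x, conv J U x) ∈ Set.Icc ((-1, -1) : ℝ × ℝ) (1, 1) :=
    ⟨⟨(abs_le.1 (hUabs x)).1, (abs_le.1 (hconv x)).1⟩,
      ⟨(abs_le.1 (hUabs x)).2, (abs_le.1 (hconv x)).2⟩⟩
  have h1 := hT _ hp
  rw [hf1, Prod.mk_sub_mk, fderiv_apply_eq_partial (hf.differentiable two_ne_zero)] at h1
  have h2 : ‖((U x - 1, conv J U x - 1) : ℝ × ℝ)‖ ^ 2 ≤ (1 - U x) ^ 2 + (1 - conv J U x) ^ 2 := by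
    rw [Prod.norm_mk]
    rcases max_choice ‖U x - 1‖ ‖conv J U x - 1‖ with hm | hm <;>
      rw [hm, Real.norm_eq_abs, sq_abs] <;>
      linarith [sq_nonneg (1 - U x), sq_nonneg (1 - conv J U x)]
  refine le_trans (le_of_eq ?_) (h1.trans (mul_le_mul_of_nonneg_left h2 hC))
  have heq := h.equation x
  congr 1
  linear_combination heq

/-- The reflected wave. -/
theorem reflect (h : IsTravelingWave d J f c U) (hJ : IsKernel J) :
    IsTravelingWave d J (fun p => -f (-p)) (-c) (fun x => -U (-x)) := by
  have hd1 : deriv (fun x => -U (-x)) = fun x => deriv U (-x) := by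
    ext x
    rw [deriv.fun_neg, deriv_comp_neg, neg_neg]
  have hconv : ∀ x, conv J (fun x => -U (-x)) x = -conv J U (-x) := by
    intro x
    rw [conv_eq, conv_eq, ← integral_neg, ← integral_neg_eq_self]
    congr 1
    ext s
    rw [hJ.even, show -(x - -s) = -x - s by ring]
    ring
  refine ⟨(h.contDiff.comp contDiff_neg).neg, fun x => ?_, ?_, ?_, fun x => ?_⟩
  · rw [hd1, deriv_comp_neg, hconv]
    have := h.equation (-x)
    simp only [Prod.neg_mk, neg_neg]
    linarith
  · simpa using (h.tendsto_atBot.comp tendsto_neg_atTop_atBot).neg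
  · exact (h.tendsto_atTop.comp tendsto_neg_atBot_atTop).neg
  · rw [hd1]
    exact h.deriv_pos (-x)

end IsTravelingWave

theorem partialR_reflect (f : ℝ × ℝ → ℝ) (r s : ℝ) :
    partialR (fun p => -f (-p)) r s = partialR f (-r) (-s) := by
  simp only [partialR, Prod.neg_mk]
  rw [deriv.fun_neg, deriv_comp_neg (f := fun r => f (r, -s)), neg_neg]

theorem partialS_reflect (f : ℝ × ℝ → ℝ) (r s : ℝ) :
    partialS (fun p => -f (-p)) r s = partialS f (-r) (-s) := by
  simp only [partialS, Prod.neg_mk]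
  rw [deriv.fun_neg, deriv_comp_neg (f := fun s => f (-r, s)), neg_neg]

theorem symb_reflect (hJ : IsKernel J) (d c a b x : ℝ) :
    symb d (-c) a b J (-x) = symb d c a b J x := by
  simp only [symb, expMoment_neg hJ]
  ring

end

end NonlocalWave

/-! ### Asymptotics at both ends. -/

theorem mainTheorem1 (d c q : ℝ) (α : ℝ≥0) (J U : ℝ → ℝ) (f : ℝ × ℝ → ℝ)
    (hd : 0 ≤ d) (hdc : d + |c| ≠ 0)
    (hα : 0 < α) (hα1 : α ≤ 1)
    (hJ : NonlocalWave.IsKernel J)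
    (hf : NonlocalWave.IsNonlinearity α q f)
    (hU : NonlocalWave.IsTravelingWave d J f c U) :
    ∃ lsPlus luPlus lsMinus luMinus : ℝ,
      NonlocalWave.HasRealRoots (NonlocalWave.charFnAt d c J f 1) lsPlus luPlus ∧
      NonlocalWave.HasRealRoots (NonlocalWave.charFnAt d c J f (-1)) lsMinus luMinus ∧
      ∃ D₁ D₂ : ℝ, 0 < D₁ ∧ 0 < D₂ ∧
        (∃ ε : ℝ → ℝ, Tendsto ε atTop (𝓝 0) ∧
          ∀ ξ, U ξ = 1 - D₁ * Real.exp (lsPlus * ξ) * (1 + ε ξ)) ∧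
        (∃ ε : ℝ → ℝ, Tendsto ε atBot (𝓝 0) ∧
          ∀ ξ, U ξ = -1 + D₂ * Real.exp (luMinus * ξ) * (1 + ε ξ)) := by
  have hdc' : 0 < d ∨ c ≠ 0 := by
    rcases hd.eq_or_lt with rfl | h
    · exact Or.inr fun hc => hdc (by simp [hc])
    · exact Or.inl h
  have hsp := hf.partialS_pos 1 (by norm_num) 1 (by norm_num)
  have hsm := hf.partialS_pos (-1) (by norm_num) (-1) (by norm_num)
  have hC2 := hf.smooth.contDiff
  obtain ⟨lsP, luP, hP, hlsP, -⟩ := NonlocalWave.exists_hasRealRoots (c := c)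
    (a := NonlocalWave.partialR f 1 1) hJ hd hsp
    (by linarith [hf.stable_one])
  obtain ⟨lsM, luM, hM, -, hluM⟩ := NonlocalWave.exists_hasRealRoots (c := c)
    (a := NonlocalWave.partialR f (-1) (-1)) hJ hd hsm
    (by linarith [hf.stable_neg_one])
  obtain ⟨C₁, R₁, w₁, w₁', h₁⟩ := hU.isTail hd hJ hC2 hf.zero_one hsp hf.stable_one
  obtain ⟨D₁, hD₁, hlim₁⟩ := h₁.exists_pos_tendsto_tilt (μ := -lsP) (by linarith [hP.1])
    (by rwa [neg_neg]) hdc'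
  -- Reflection replaces `c` by `-c` and so the symbol at `x` by that at `-x`: the positive root at
  -- `-1` becomes the decay rate at `+∞`.
  obtain ⟨C₂, R₂, w₂, w₂', h₂⟩ := (hU.reflect hJ).isTail hd hJ (hC2.comp contDiff_neg).neg
    (by simp [hf.zero_neg_one]) (by rwa [NonlocalWave.partialS_reflect])
    (by rw [NonlocalWave.partialS_reflect, NonlocalWave.partialR_reflect]; exact hf.stable_neg_one)
  rw [NonlocalWave.partialS_reflect, NonlocalWave.partialR_reflect] at h₂
  obtain ⟨D₂, hD₂, hlim₂⟩ := h₂.exists_pos_tendsto_tilt (μ := luM) hM.2.1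
    (by rwa [NonlocalWave.symb_reflect hJ]) (hdc'.imp_right neg_ne_zero.2)
  -- Each `ε` is forced by solving the expansion for the relative error.
  refine ⟨lsP, luP, lsM, luM, hP, hM, D₁, D₂, hD₁, hD₂,
    ⟨fun ξ => (1 - U ξ) * Real.exp (-lsP * ξ) / D₁ - 1, ?_, fun ξ => ?_⟩,
    ⟨fun ξ => (1 + U ξ) * Real.exp (-luM * ξ) / D₂ - 1, ?_, fun ξ => ?_⟩⟩
  · simpa [hD₁.ne'] using (hlim₁.div_const D₁).sub_const 1
  · have : Real.exp (lsP * ξ) * Real.exp (-(lsP * ξ)) = 1 := by rw [← Real.exp_add]; simp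
    field_simp
    linear_combination (1 - U ξ) * this
  · have := ((hlim₂.comp tendsto_neg_atBot_atTop).div_const D₂).sub_const 1
    simpa [hD₂.ne', Function.comp_def] using this
  · have : Real.exp (luM * ξ) * Real.exp (-(luM * ξ)) = 1 := by rw [← Real.exp_add]; simp
    field_simp
    linear_combination -(1 + U ξ) * this
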